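/- Let $W=S_n$ be the symmetric group, with simple reflections $(i\;\,i+1)$, length function $\ell$, and reflections the transpositions. The *Bruhat graph* has an edge $x\to y$, labeled by $yx^{-1}$, whenever $yx^{-1}$ is a reflection and $\ell(x)<\ell(y)$; the *Bruhat order* is defined by $x\le y$ iff there is a path from $x$ to $y$ in this graph, and $[u,v]=\{x : u\le x\le v\}$. Let $R_{u,v}\in\mathbb Z[q]$ be the Kazhdan–Lusztig $R$-polynomials, i.e. the unique family such that $R_{u,v}=0$ if $u\not\le v$, $R_{u,u}=1$, and, whenever $u<v$ and $s$ is a simple reflection with $sv<v$, $R_{u,v}=R_{su,sv}$ if $su<u$ and $R_{u,v}=(q-1)R_{u,sv}+qR_{su,sv}$ if $su>u$. Let $\widetilde R_{u,v}\in\mathbb Z[q]$ be the unique polynomial with $$R_{u,v}(q)=q^{(\ell(v)-\ell(u))/2}\,\widetilde R_{u,v}(q^{1/2}-q^{-1/2}).$$ For an order ideal $I$ of $[u,v]$ put $$\widetilde R_{u,v,I}(q)=\sum_{x\in I}\widetilde R_{u,x}(-q)\,\widetilde R_{x,v}(q).$$ A *reflection order* is a total order $\prec$ on the set of transpositions such that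 for all $a<b<c$ either $(a\,b)\prec(a\,c)\prec(b\,c)$ or $(b\,c)\prec(a\,c)\prec(a\,b)$. The length $\ell(\gamma)$ of a path $\gamma$ in the Bruhat graph is its number of edges. A path, or a part of one, is *$\prec$-increasing* (*$\prec$-decreasing*) if its edge labels, in the order in which the path traverses them, strictly increase (decrease) with respect to $\prec$. **Proposition.** Let $u,v\in S_n$. 1. If $I=[u,v]$, then $\widetilde R_{u,v,I}=1$ if $u=v$, and $\widetilde R_{u,v,I}=0$ otherwise. 2. If $I$ is a nonempty order ideal of $[u,v]$ with $I\neq[u,v]$, and $\prec$ is any reflection order, then $$\widetilde R_{u,v,I}=\sum_{\gamma\in\Gamma^I_\prec(u,v)}(-1)^{\ell(\gamma|_I)}\,q^{\ell(\gamma)},$$ where $\Gamma^I_\prec(u,v)$ is the set of paths $\gamma$ from $u$ to $v$ in the Bruhat graph with the following property: if $x$ is the last vertex of $\gamma$ lying in $I$ and $\mathrm{next}(x)$ is the vertex following $x$ on $\gamma$, then $\gamma$ is $\prec$-decreasing from $u$ to $\mathrm{next}(x)$ and $\prec$-increasing from $x$ to $v$. Here $\gamma|_I$ is the part of $\gamma$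 lying in $I$, which is the initial segment of $\gamma$ from $u$ to $x$. -/

import Mathlib

open Polynomial

namespace BruhatGraph

variable {n : ℕ}

/-- The simple reflections `(i i+1)` of the symmetric group on `Fin n`. -/
def IsSimple (s : Equiv.Perm (Fin n)) : Prop :=
  ∃ (i : ℕ) (h : i + 1 < n), s = Equiv.swap ⟨i, Nat.lt_of_succ_lt h⟩ ⟨i + 1, h⟩

/-- Coxeter length: the least length of a word in the simple reflections with product `w`. -/
noncomputable def len (w : Equiv.Perm (Fin n)) : ℕ :=
  sInf {k | ∃ l : List (Equiv.Perm (Fin n)), (∀ s ∈ l, IsSimple s) ∧ l.prod = w ∧ l.length = k}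

/-- The edge relation `x → y` of the Bruhat graph. The reflections of the symmetric group are
the transpositions. -/
def Edge (x y : Equiv.Perm (Fin n)) : Prop :=
  (y * x⁻¹).IsSwap ∧ len x < len y

/-- The Bruhat order: `x ≤ y` iff the Bruhat graph has a path from `x` to `y`. -/
def BruhatLE (x y : Equiv.Perm (Fin n)) : Prop := Relation.ReflTransGen Edge x y

/-- The strict Bruhat order. -/
def BruhatLT (x y : Equiv.Perm (Fin n)) : Prop := BruhatLE x y ∧ x ≠ y

open Classical in
/-- The Bruhat interval `[u, v]`. -/
noncomputable def interval (u v : Equiv.Perm (Fin n)) : Finset (Equiv.Perm (Fin n)) :=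
  Finset.univ.filter fun x => BruhatLE u x ∧ BruhatLE x v

/-- The conditions that characterize the family of Kazhdan--Lusztig `R`-polynomials. -/
structure IsRFamily (R : Equiv.Perm (Fin n) → Equiv.Perm (Fin n) → ℤ[X]) : Prop where
  zero : ∀ u v, ¬ BruhatLE u v → R u v = 0
  one : ∀ u, R u u = 1
  descent : ∀ u v s, BruhatLT u v → IsSimple s → BruhatLT (s * v) v → BruhatLT (s * u) u →
    R u v = R (s * u) (s * v)
  ascent : ∀ u v s, BruhatLT u v → IsSimple s → BruhatLT (s * v) v → BruhatLT u (s * u) →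
    R u v = (X - 1) * R u (s * v) + X * R (s * u) (s * v)

/-- The `R`-polynomials: the (unique) family satisfying `IsRFamily`. -/
noncomputable def R : Equiv.Perm (Fin n) → Equiv.Perm (Fin n) → ℤ[X] :=
  Classical.epsilon IsRFamily

/-- `p` satisfies `R_{u,v}(q) = q^{(ℓ(v) - ℓ(u)) / 2} p(q^{1/2} - q^{-1/2})`. The identity is one of
Laurent polynomials in the variable `T = q^{1/2}`. -/
def IsRTilde (u v : Equiv.Perm (Fin n)) (p : ℤ[X]) : Prop :=
  aeval (LaurentPolynomial.T 2 : LaurentPolynomial ℤ) (R u v) =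
    LaurentPolynomial.T ((len v : ℤ) - (len u : ℤ)) *
      aeval (LaurentPolynomial.T 1 - LaurentPolynomial.T (-1) : LaurentPolynomial ℤ) p

/-- The polynomial `R̃_{u,v}`: the (unique) polynomial satisfying `IsRTilde u v`. -/
noncomputable def RTilde (u v : Equiv.Perm (Fin n)) : ℤ[X] :=
  Classical.epsilon (IsRTilde u v)

/-- `I` is an order ideal (lower set) of the poset `[u, v]`. -/
def IsOrderIdeal (u v : Equiv.Perm (Fin n)) (I : Finset (Equiv.Perm (Fin n))) : Prop :=
  I ⊆ interval u v ∧ ∀ x ∈ I, ∀ y ∈ interval u v, BruhatLE y x → y ∈ I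

/-- The relative polynomial `R̃_{u,v,I}(q) = ∑_{x ∈ I} R̃_{u,x}(-q) R̃_{x,v}(q)`. -/
noncomputable def relRTilde (u v : Equiv.Perm (Fin n)) (I : Finset (Equiv.Perm (Fin n))) : ℤ[X] :=
  ∑ x ∈ I, (RTilde u x).comp (-X) * RTilde x v

/-- `prec` restricts to a reflection order on the set of transpositions (the values of `prec`
at permutations that are not transpositions play no role). -/
structure IsReflectionOrder (prec : Equiv.Perm (Fin n) → Equiv.Perm (Fin n) → Prop) : Prop where
  total : IsStrictTotalOrder {t : Equiv.Perm (Fin n) // t.IsSwap} (fun s t => prec s.1 t.1)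
  triple : ∀ a b c : Fin n, a < b → b < c →
    (prec (Equiv.swap a b) (Equiv.swap a c) ∧ prec (Equiv.swap a c) (Equiv.swap b c)) ∨
    (prec (Equiv.swap b c) (Equiv.swap a c) ∧ prec (Equiv.swap a c) (Equiv.swap a b))

/-- `γ` is the vertex list of a path `u = x₀ → x₁ → ⋯ → x_k = v` in the Bruhat graph. -/
def IsPath (u v : Equiv.Perm (Fin n)) (γ : List (Equiv.Perm (Fin n))) : Prop :=
  γ.IsChain Edge ∧ γ.head? = some u ∧ γ.getLast? = some v

/-- The edge labels `t_i = x_i x_{i-1}⁻¹` along a vertex list. -/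
def labels (γ : List (Equiv.Perm (Fin n))) : List (Equiv.Perm (Fin n)) :=
  List.zipWith (fun x y => y * x⁻¹) γ γ.tail

/-- `t₁ ≺ t₂ ≺ ⋯ ≺ t_k`. -/
def Increasing (prec : Equiv.Perm (Fin n) → Equiv.Perm (Fin n) → Prop)
    (γ : List (Equiv.Perm (Fin n))) : Prop :=
  (labels γ).IsChain prec

/-- `t_k ≺ ⋯ ≺ t₂ ≺ t₁`. -/
def Decreasing (prec : Equiv.Perm (Fin n) → Equiv.Perm (Fin n) → Prop)
    (γ : List (Equiv.Perm (Fin n))) : Prop :=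
  (labels γ).IsChain fun s t => prec t s

/-- The length (number of edges) of the path with vertex list `γ`. -/
def pathLength (γ : List (Equiv.Perm (Fin n))) : ℕ := γ.length - 1

/-- The restriction `γ|_I`: the part of `γ` that lies in `I`. -/
def restrict (γ : List (Equiv.Perm (Fin n))) (I : Finset (Equiv.Perm (Fin n))) :
    List (Equiv.Perm (Fin n)) :=
  γ.filter fun x => x ∈ I

/-- `γ` is a path from `u` to `v` which is decreasing from `u` to the vertex `next(x)` following `x`
and increasing from `x` to `v`, where `x` is the last vertex of `γ` that lies in `I`. Here `α` is
the part of `γ` before `x`, and `β` the part after `x`, so that `next(x)`, if it exists, is the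
first entry of `β`. -/
def IsIdealPath (prec : Equiv.Perm (Fin n) → Equiv.Perm (Fin n) → Prop)
    (I : Finset (Equiv.Perm (Fin n))) (u v : Equiv.Perm (Fin n))
    (γ : List (Equiv.Perm (Fin n))) : Prop :=
  IsPath u v γ ∧ ∃ α x β, γ = α ++ x :: β ∧ x ∈ I ∧ (∀ y ∈ β, y ∉ I) ∧
    Decreasing prec (α ++ x :: β.take 1) ∧ Increasing prec (x :: β)

theorem finite_setOf_isIdealPath (prec : Equiv.Perm (Fin n) → Equiv.Perm (Fin n) → Prop)
    (I : Finset (Equiv.Perm (Fin n))) (u v : Equiv.Perm (Fin n)) :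
    {γ | IsIdealPath prec I u v γ}.Finite := by
  refine (List.finite_length_le (Equiv.Perm (Fin n))
    (Fintype.card (Equiv.Perm (Fin n)))).subset ?_
  rintro γ ⟨⟨h, -⟩, -⟩
  have h1 : γ.IsChain (fun x y => len x < len y) := h.imp fun _ _ h => h.2
  have h2 : (γ.map len).IsChain (· < ·) := (List.isChain_map len).2 h1
  exact List.Nodup.length_le_card (List.Nodup.of_map len (h2.pairwise.imp fun h => ne_of_lt h))

/-- The (finite) set of the paths of `IsIdealPath`. -/
noncomputable def idealPaths (prec : Equiv.Perm (Fin n) → Equiv.Perm (Fin n) → Prop)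
    (I : Finset (Equiv.Perm (Fin n))) (u v : Equiv.Perm (Fin n)) :
    Finset (List (Equiv.Perm (Fin n))) :=
  (finite_setOf_isIdealPath prec I u v).toFinset

end BruhatGraph

namespace BruhatGraph

variable {n : ℕ}

/-! The proof rests on Dyer's formula: `R̃_{u,v}` is the sum of `q^{ℓ(γ)}` over the increasing paths
`γ` from `u` to `v`, for any reflection order. Since the reverse of a reflection order is again one,
decreasing paths give the same polynomial.

For Dyer's formula, let `t₁ ≺ ⋯ ≺ t_N` be all transpositions. Applying the operators `raise t_i`
successively to a delta function counts increasing paths (`incPoly`). Right multiplication by a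
simple reflection does not change the labels `y x⁻¹`, so a right Hecke-type operator passes through
one factor `raise t` after another (`rightOp_raise`). Each passage reverses the pair belonging to
`t` in a comparison relation, and after all of them `<` has become `>`. The left operators commute
with the right ones and agree with them at the identity, which gives the same exchange on the left
(`leftOp_lt_foldr_raise_single`). Evaluated at a point, this is the recursion for `R̃`
(`incPoly_rec`).

By Dyer's formula for both directions, `R̃_{u,v,I}` counts paths with a marked vertex in `I`,
decreasing up to the mark and increasing after it, with sign `(-1)^i` for a mark at position `i`. At
an inner mark the two adjacent labels compare in exactly one way, so the marked vertex can be traded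
for a marked edge (`valleyAt_succ`). Summation by parts then leaves only edges along which
membership in `I` changes (`sum_marked_eq`). For `I = [u,v]` with `u ≠ v` there are none; for a
proper nonempty ideal there is one, the exit from `I`. -/

/-! ### Coxeter length and inversions. -/

/-- The inversions of `w`, as pairs of values. -/
def inversions (w : Equiv.Perm (Fin n)) : Finset (Fin n × Fin n) :=
  Finset.univ.filter fun p => p.1 < p.2 ∧ w⁻¹ p.2 < w⁻¹ p.1

theorem mem_inversions {w : Equiv.Perm (Fin n)} {p : Fin n × Fin n} :
    p ∈ inversions w ↔ p.1 < p.2 ∧ w⁻¹ p.2 < w⁻¹ p.1 := by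
  simp [inversions]

/-- No value lies strictly between `i` and `j`, so the swap can reverse only the comparison of these
two. -/
theorem swap_succ_lt {i j x y : Fin n} (hij : i.val + 1 = j.val) (hxy : x < y)
    (hne : ¬ (x = i ∧ y = j)) : Equiv.swap i j x < Equiv.swap i j y := by
  simp only [Equiv.swap_apply_def]
  simp only [Fin.ext_iff, Fin.lt_def] at *
  split_ifs <;> omega

theorem swap_succ_lt_iff {i j x y : Fin n} (hij : i.val + 1 = j.val)
    (h1 : ¬ (x = i ∧ y = j)) (h2 : ¬ (x = j ∧ y = i)) :
    Equiv.swap i j x < Equiv.swap i j y ↔ x < y := by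
  refine ⟨fun h => ?_, fun h => swap_succ_lt hij h h1⟩
  have := swap_succ_lt hij h ?_
  · simpa using this
  · rintro ⟨hx, hy⟩
    rw [Equiv.swap_apply_eq_iff, Equiv.swap_apply_left] at hx
    rw [Equiv.swap_apply_eq_iff, Equiv.swap_apply_right] at hy
    exact h2 ⟨hx, hy⟩

theorem card_inversions_swap_succ_mul {i j : Fin n} (hij : i.val + 1 = j.val)
    {w : Equiv.Perm (Fin n)} (hw : w⁻¹ i < w⁻¹ j) :
    (inversions (Equiv.swap i j * w)).card = (inversions w).card + 1 := by
  have hlt : i < j := by rw [Fin.lt_def]; omega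
  have key : inversions (Equiv.swap i j * w) =
      insert (i, j) ((inversions w).image (Prod.map (Equiv.swap i j) (Equiv.swap i j))) := by
    ext ⟨x, y⟩
    simp only [mem_inversions, Finset.mem_insert, Finset.mem_image, Prod.exists, Prod.map_apply,
      Prod.mk.injEq, mul_inv_rev, Equiv.swap_inv, Equiv.Perm.mul_apply]
    constructor
    · rintro ⟨hxy, h⟩
      by_cases hne : x = i ∧ y = j
      · exact Or.inl hne
      · exact Or.inr ⟨Equiv.swap i j x, Equiv.swap i j y, ⟨swap_succ_lt hij hxy hne, h⟩,
          by simp, by simp⟩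
    · rintro (⟨rfl, rfl⟩ | ⟨a, b, ⟨hab, h⟩, rfl, rfl⟩)
      · simpa using ⟨hlt, hw⟩
      · refine ⟨swap_succ_lt hij hab ?_, by simpa using h⟩
        rintro ⟨rfl, rfl⟩
        exact lt_asymm h hw
  rw [key, Finset.card_insert_of_notMem, Finset.card_image_of_injective]
  · exact Function.Injective.prodMap (Equiv.injective _) (Equiv.injective _)
  · simp only [Finset.mem_image, Prod.exists, Prod.map_apply, Prod.mk.injEq, not_exists]
    rintro a b ⟨h, ha, hb⟩
    rw [Equiv.swap_apply_eq_iff, Equiv.swap_apply_left] at ha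
    rw [Equiv.swap_apply_eq_iff, Equiv.swap_apply_right] at hb
    subst ha hb
    exact lt_asymm (mem_inversions.1 h).1 hlt

theorem card_inversions_swap_succ_mul' {i j : Fin n} (hij : i.val + 1 = j.val)
    {w : Equiv.Perm (Fin n)} (hw : w⁻¹ j < w⁻¹ i) :
    (inversions (Equiv.swap i j * w)).card + 1 = (inversions w).card := by
  have := card_inversions_swap_succ_mul hij (w := Equiv.swap i j * w) (by simpa using hw)
  rw [← this, Equiv.swap_mul_self_mul]

theorem card_inversions_one : (inversions (1 : Equiv.Perm (Fin n))).card = 0 := by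
  rw [Finset.card_eq_zero, Finset.eq_empty_iff_forall_notMem]
  intro p hp
  exact lt_asymm (mem_inversions.1 hp).1 (by simpa using (mem_inversions.1 hp).2)

theorem eq_one_of_forall_succ_lt {w : Equiv.Perm (Fin n)}
    (h : ∀ i j : Fin n, i.val + 1 = j.val → w⁻¹ i < w⁻¹ j) : w = 1 := by
  cases n with
  | zero => exact Subsingleton.elim _ _
  | succ m =>
    have hm : StrictMono (w⁻¹ : Equiv.Perm (Fin (m + 1))) :=
      Fin.strictMono_iff_lt_succ.2 fun i => h _ _ (by simp)
    have : (w⁻¹ : Equiv.Perm (Fin (m + 1))) = 1 := by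
      ext x
      have := Subsingleton.elim (hm.orderIsoOfSurjective _ (w⁻¹).surjective) (OrderIso.refl _)
      simpa using congrArg Fin.val (DFunLike.congr_fun this x)
    simpa using this

theorem exists_succ_lt_of_ne_one {w : Equiv.Perm (Fin n)} (h : w ≠ 1) :
    ∃ i j : Fin n, i.val + 1 = j.val ∧ w⁻¹ j < w⁻¹ i := by
  by_contra! hc
  exact h (eq_one_of_forall_succ_lt fun i j hij => lt_of_le_of_ne (hc i j hij) fun he => by
    have := (w⁻¹).injective he
    subst this
    omega)

theorem isSimple_iff {s : Equiv.Perm (Fin n)} :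
    IsSimple s ↔ ∃ i j : Fin n, i.val + 1 = j.val ∧ s = Equiv.swap i j := by
  constructor
  · rintro ⟨i, h, rfl⟩
    exact ⟨_, _, rfl, rfl⟩
  · rintro ⟨⟨i, hi⟩, ⟨j, hj⟩, h, rfl⟩
    obtain rfl : i + 1 = j := h
    exact ⟨i, hj, rfl⟩

theorem card_inversions_prod_le (l : List (Equiv.Perm (Fin n))) (hl : ∀ s ∈ l, IsSimple s) :
    (inversions l.prod).card ≤ l.length := by
  induction l with
  | nil => simp [card_inversions_one]
  | cons s l ih =>
    obtain ⟨i, j, hij, rfl⟩ := isSimple_iff.1 (hl s (by simp))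
    have ih := ih fun s hs => hl s (by simp [hs])
    rw [List.prod_cons, List.length_cons]
    rcases lt_trichotomy (l.prod⁻¹ i) (l.prod⁻¹ j) with h | h | h
    · rw [card_inversions_swap_succ_mul hij h]; omega
    · have := (l.prod⁻¹).injective h
      subst this; omega
    · have := card_inversions_swap_succ_mul' hij h; omega

theorem exists_word (w : Equiv.Perm (Fin n)) : ∃ l : List (Equiv.Perm (Fin n)),
    (∀ s ∈ l, IsSimple s) ∧ l.prod = w ∧ l.length = (inversions w).card := by
  induction hk : (inversions w).card generalizing w with
  | zero =>
    by_cases h : w = 1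
    · exact ⟨[], by simp, by simp [h], rfl⟩
    · obtain ⟨i, j, hij, hlt⟩ := exists_succ_lt_of_ne_one h
      have := card_inversions_swap_succ_mul' hij hlt
      omega
  | succ k ih =>
    have h : w ≠ 1 := by rintro rfl; rw [card_inversions_one] at hk; omega
    obtain ⟨i, j, hij, hlt⟩ := exists_succ_lt_of_ne_one h
    obtain ⟨l, hl, hp, hlen⟩ := ih (Equiv.swap i j * w) (by
      have := card_inversions_swap_succ_mul' hij hlt
      omega)
    refine ⟨Equiv.swap i j :: l, ?_, ?_, by simp [hlen]⟩
    · intro s hs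
      rcases List.mem_cons.1 hs with rfl | hs
      · exact isSimple_iff.2 ⟨i, j, hij, rfl⟩
      · exact hl s hs
    · rw [List.prod_cons, hp, Equiv.swap_mul_self_mul]

theorem len_eq_card_inversions (w : Equiv.Perm (Fin n)) : len w = (inversions w).card := by
  apply le_antisymm
  · exact Nat.sInf_le (exists_word w)
  · obtain ⟨l, hl, rfl, hlen⟩ := Nat.sInf_mem (s := {k | ∃ l : List (Equiv.Perm (Fin n)),
      (∀ s ∈ l, IsSimple s) ∧ l.prod = w ∧ l.length = k}) ⟨_, exists_word w⟩
    have := card_inversions_prod_le l hl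
    unfold len
    omega

theorem len_swap_succ_mul {i j : Fin n} (hij : i.val + 1 = j.val)
    {w : Equiv.Perm (Fin n)} (hw : w⁻¹ i < w⁻¹ j) :
    len (Equiv.swap i j * w) = len w + 1 := by
  simp only [len_eq_card_inversions, card_inversions_swap_succ_mul hij hw]

theorem len_swap_succ_mul' {i j : Fin n} (hij : i.val + 1 = j.val)
    {w : Equiv.Perm (Fin n)} (hw : w⁻¹ j < w⁻¹ i) :
    len (Equiv.swap i j * w) + 1 = len w := by
  simp only [len_eq_card_inversions, card_inversions_swap_succ_mul' hij hw]

theorem len_one : len (1 : Equiv.Perm (Fin n)) = 0 := by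
  rw [len_eq_card_inversions, card_inversions_one]

/-- With `c = b - 1`, conjugation by `(c b)` reduces `(a b)` to the shorter `(a c)`. The two outer
factors change the length by one each; if both lowered it, then `w⁻¹ b < w⁻¹ c < w⁻¹ a`, against the
hypothesis. -/
theorem len_lt_len_swap_mul {a b : Fin n} (hab : a < b) {w : Equiv.Perm (Fin n)}
    (hw : w⁻¹ a < w⁻¹ b) : len w < len (Equiv.swap a b * w) := by
  induction hd : b.val - a.val using Nat.strong_induction_on generalizing a b w with
  | _ d ih =>
  rcases eq_or_ne (a.val + 1) b.val with h | h
  · rw [len_swap_succ_mul h hw]; omega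
  have hab' := Fin.lt_def.1 hab
  obtain ⟨c, hc⟩ : ∃ c : Fin n, c.val + 1 = b.val := ⟨⟨b.val - 1, by omega⟩, by simp; omega⟩
  have hac : a < c := by rw [Fin.lt_def]; omega
  have hcb : c < b := by rw [Fin.lt_def]; omega
  have conj : Equiv.swap a b * w =
      Equiv.swap c b * (Equiv.swap a c * (Equiv.swap c b * w)) := by
    have : Equiv.swap a b = Equiv.swap c b * Equiv.swap a c * Equiv.swap c b := by
      rw [Equiv.swap_mul_swap_mul_swap hac.ne hab.ne, Equiv.swap_comm]
    rw [this]; simp only [mul_assoc]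
  have na : Equiv.swap c b a = a := Equiv.swap_apply_of_ne_of_ne hac.ne hab.ne
  have nb : Equiv.swap a c b = b := Equiv.swap_apply_of_ne_of_ne hab.ne' hcb.ne'
  have h2 : len (Equiv.swap c b * w) < len (Equiv.swap a c * (Equiv.swap c b * w)) :=
    ih (c.val - a.val) (by omega) hac (by simpa [na] using hw) rfl
  rw [conj]
  have e1 : (Equiv.swap a c * (Equiv.swap c b * w))⁻¹ c = w⁻¹ a := by simp [na]
  have e2 : (Equiv.swap a c * (Equiv.swap c b * w))⁻¹ b = w⁻¹ c := by simp [nb]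
  have n1 : w⁻¹ c ≠ w⁻¹ b := fun h => hcb.ne ((w⁻¹).injective h)
  have n2 : w⁻¹ a ≠ w⁻¹ c := fun h => hac.ne ((w⁻¹).injective h)
  rcases lt_or_gt_of_ne n1 with hcb' | hcb' <;> rcases lt_or_gt_of_ne n2 with hac' | hac'
  · have h1 := len_swap_succ_mul hc hcb'
    have h3 := len_swap_succ_mul hc (w := Equiv.swap a c * (Equiv.swap c b * w))
      (by rwa [e1, e2])
    omega
  · have h1 := len_swap_succ_mul hc hcb'
    have h3 := len_swap_succ_mul' hc (w := Equiv.swap a c * (Equiv.swap c b * w))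
      (by rwa [e1, e2])
    omega
  · have h1 := len_swap_succ_mul' hc hcb'
    have h3 := len_swap_succ_mul hc (w := Equiv.swap a c * (Equiv.swap c b * w))
      (by rwa [e1, e2])
    omega
  · exact absurd (hw.trans hcb') (lt_asymm hac')

theorem len_lt_len_swap_mul_iff {a b : Fin n} (hab : a < b) {w : Equiv.Perm (Fin n)} :
    len w < len (Equiv.swap a b * w) ↔ w⁻¹ a < w⁻¹ b := by
  refine ⟨fun h => ?_, len_lt_len_swap_mul hab⟩
  by_contra hc
  have hne : w⁻¹ a ≠ w⁻¹ b := fun h => hab.ne ((w⁻¹).injective h)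
  have := len_lt_len_swap_mul hab (w := Equiv.swap a b * w)
    (by simpa using lt_of_le_of_ne (not_lt.1 hc) hne.symm)
  rw [Equiv.swap_mul_self_mul] at this
  exact lt_asymm h this

theorem len_pos_of_ne_one {w : Equiv.Perm (Fin n)} (h : w ≠ 1) : 0 < len w := by
  obtain ⟨i, j, hij, hlt⟩ := exists_succ_lt_of_ne_one h
  have := len_swap_succ_mul' hij hlt
  omega

/-! ### Hecke-type operators and their exchange relations. -/

open Classical in
/-- The polynomial `q` if `p` holds and `0` otherwise. -/
noncomputable def indX (p : Prop) : ℤ[X] := if p then X else 0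

@[simp] theorem indX_true : indX True = X := if_pos trivial

@[simp] theorem indX_false : indX False = 0 := if_neg id

theorem indX_of {p : Prop} (h : p) : indX p = X := if_pos h

theorem indX_of_not {p : Prop} (h : ¬ p) : indX p = 0 := if_neg h

/-- The operator `f ↦ f + q f(t ·)` restricted to the edges `u → t u` of the Bruhat graph. -/
noncomputable def raise (t : Equiv.Perm (Fin n)) (f : Equiv.Perm (Fin n) → ℤ[X]) :
    Equiv.Perm (Fin n) → ℤ[X] :=
  fun u => f u + indX (len u < len (t * u)) * f (t * u)

/-- The Hecke-type operator for right multiplication by `(i j)`, where `r` decides at which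
permutations the term with coefficient `q` occurs. -/
noncomputable def rightOp (r : Fin n → Fin n → Prop) (i j : Fin n)
    (f : Equiv.Perm (Fin n) → ℤ[X]) : Equiv.Perm (Fin n) → ℤ[X] :=
  fun u => f (u * Equiv.swap i j) + indX (r (u i) (u j)) * f u

/-- The Hecke-type operator for left multiplication by `(i j)`, where `r` decides at which
permutations the term with coefficient `q` occurs. -/
noncomputable def leftOp (r : Fin n → Fin n → Prop) (i j : Fin n)
    (f : Equiv.Perm (Fin n) → ℤ[X]) : Equiv.Perm (Fin n) → ℤ[X] :=
  fun u => f (Equiv.swap i j * u) + indX (r (u⁻¹ i) (u⁻¹ j)) * f u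

/-- If `u` maps `{k, l}` onto `{i, j}`, both multiplications move `u` to the same element and the
two operators agree there. Otherwise neither adjacent swap affects the comparison made by the other
operator. -/
theorem leftOp_rightOp_comm {r : Fin n → Fin n → Prop} (hr : r = (· < ·) ∨ r = (· > ·))
    {i j k l : Fin n} (hij : i.val + 1 = j.val) (hkl : k.val + 1 = l.val)
    (f : Equiv.Perm (Fin n) → ℤ[X]) :
    leftOp r i j (rightOp r k l f) = rightOp r k l (leftOp r i j f) := by
  have hij' : i < j := by rw [Fin.lt_def]; omega
  have hkl' : k < l := by rw [Fin.lt_def]; omega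
  funext u
  simp only [leftOp, rightOp, mul_assoc, mul_inv_rev, Equiv.swap_inv, Equiv.Perm.mul_apply]
  by_cases h1 : u k = i ∧ u l = j
  · obtain ⟨rfl, rfl⟩ := h1
    have e : Equiv.swap (u k) (u l) * u = u * Equiv.swap k l := by
      rw [Equiv.mul_swap_eq_swap_mul]
    rcases hr with rfl | rfl <;>
    · simp [e, hij', hkl', hij'.not_gt, hkl'.not_gt]
      try ring
  by_cases h2 : u l = i ∧ u k = j
  · obtain ⟨rfl, rfl⟩ := h2
    have e : Equiv.swap (u l) (u k) * u = u * Equiv.swap k l := by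
      rw [Equiv.mul_swap_eq_swap_mul, Equiv.swap_comm]
    rcases hr with rfl | rfl <;>
    · simp [e, hij', hkl', hij'.not_gt, hkl'.not_gt]
      try ring
  have c1 : r (Equiv.swap i j (u k)) (Equiv.swap i j (u l)) ↔ r (u k) (u l) := by
    rcases hr with rfl | rfl
    · exact swap_succ_lt_iff hij h1 fun h => h2 ⟨h.2, h.1⟩
    · exact swap_succ_lt_iff hij h2 fun h => h1 ⟨h.2, h.1⟩
  have h1' : ¬ (u⁻¹ i = k ∧ u⁻¹ j = l) := by
    rintro ⟨rfl, rfl⟩; exact h1 ⟨by simp, by simp⟩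
  have h2' : ¬ (u⁻¹ i = l ∧ u⁻¹ j = k) := by
    rintro ⟨rfl, rfl⟩; exact h2 ⟨by simp, by simp⟩
  have c2 : r (Equiv.swap k l (u⁻¹ i)) (Equiv.swap k l (u⁻¹ j)) ↔ r (u⁻¹ i) (u⁻¹ j) := by
    rcases hr with rfl | rfl
    · exact swap_succ_lt_iff hkl h1' h2'
    · exact swap_succ_lt_iff hkl (fun h => h2' ⟨h.2, h.1⟩) fun h => h1' ⟨h.2, h.1⟩
  simp only [c1, c2]
  ring

/-- The order on `Fin n` obtained from the standard one by inverting the pairs whose transposition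
lies in `A`. -/
def twistedLT (A : Set (Equiv.Perm (Fin n))) (x y : Fin n) : Prop :=
  (x < y ∧ Equiv.swap x y ∉ A) ∨ (y < x ∧ Equiv.swap x y ∈ A)

theorem swap_eq_swap_iff {a b x y : Fin n} (hab : a ≠ b) :
    Equiv.swap x y = Equiv.swap a b ↔ (x = a ∧ y = b) ∨ (x = b ∧ y = a) := by
  constructor
  · intro h
    have h1 : Equiv.swap x y a = b := by rw [h, Equiv.swap_apply_left]
    rw [Equiv.swap_apply_def] at h1
    split_ifs at h1 <;> grind
  · rintro (⟨rfl, rfl⟩ | ⟨rfl, rfl⟩)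
    · rfl
    · exact Equiv.swap_comm _ _

/-- The hypotheses say that no third value separates `a` from `b` in the twisted relation, so the
swap affects only their mutual comparison. When `{u i, u j} = {a, b}`, left and right multiplication
coincide, and the terms match precisely because the comparison of `a` and `b` is reversed. -/
theorem rightOp_raise {A : Set (Equiv.Perm (Fin n))} {a b : Fin n} (hab : a < b)
    (hA : Equiv.swap a b ∉ A)
    (hl : ∀ x, x ≠ a → x ≠ b → (twistedLT A a x ↔ twistedLT A b x))
    (hr : ∀ x, x ≠ a → x ≠ b → (twistedLT A x a ↔ twistedLT A x b))
    {i j : Fin n} (hij : i.val + 1 = j.val) (f : Equiv.Perm (Fin n) → ℤ[X]) :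
    rightOp (twistedLT A) i j (raise (Equiv.swap a b) f) =
      raise (Equiv.swap a b) (rightOp (twistedLT (insert (Equiv.swap a b) A)) i j f) := by
  have hij' : i < j := by rw [Fin.lt_def]; omega
  funext u
  simp only [raise, rightOp, len_lt_len_swap_mul_iff hab, mul_assoc, mul_inv_rev,
    Equiv.swap_inv, Equiv.Perm.mul_apply]
  have hA' : Equiv.swap b a ∉ A := by rwa [Equiv.swap_comm]
  have ab1 : twistedLT A a b := Or.inl ⟨hab, hA⟩
  have ab2 : ¬ twistedLT A b a := by
    rintro (⟨h, -⟩ | ⟨-, h⟩)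
    · exact lt_asymm h hab
    · exact hA' h
  have ab3 : twistedLT (insert (Equiv.swap a b) A) b a :=
    Or.inr ⟨hab, Or.inl (Equiv.swap_comm _ _)⟩
  have ab4 : ¬ twistedLT (insert (Equiv.swap a b) A) a b := by
    rintro (⟨-, h⟩ | ⟨h, -⟩)
    · exact h (Or.inl rfl)
    · exact lt_asymm h hab
  by_cases h1 : u i = a ∧ u j = b
  · obtain ⟨rfl, rfl⟩ := h1
    have e : Equiv.swap (u i) (u j) * u = u * Equiv.swap i j := by
      rw [Equiv.mul_swap_eq_swap_mul]
    simp [← mul_assoc, e, hij', hij'.not_gt, ab1, ab3, ab4]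
  by_cases h2 : u j = a ∧ u i = b
  · obtain ⟨rfl, rfl⟩ := h2
    have e : Equiv.swap (u j) (u i) * u = u * Equiv.swap i j := by
      rw [Equiv.mul_swap_eq_swap_mul, Equiv.swap_comm]
    simp [← mul_assoc, e, hij', hij'.not_gt, ab2, ab3]
  have h1' : ¬ (u⁻¹ a = i ∧ u⁻¹ b = j) := by
    rintro ⟨rfl, rfl⟩; exact h1 ⟨by simp, by simp⟩
  have h2' : ¬ (u⁻¹ a = j ∧ u⁻¹ b = i) := by
    rintro ⟨rfl, rfl⟩; exact h2 ⟨by simp, by simp⟩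
  have c1 := swap_succ_lt_iff hij h1' h2'
  have c2 : ∀ x y, ¬ (x = a ∧ y = b) → ¬ (y = a ∧ x = b) →
      (twistedLT (insert (Equiv.swap a b) A) x y ↔ twistedLT A x y) := by
    intro x y hx hy
    have : Equiv.swap x y ≠ Equiv.swap a b := fun h => by
      rcases (swap_eq_swap_iff hab.ne).1 h with h | h
      · exact hx h
      · exact hy ⟨h.2, h.1⟩
    simp [twistedLT, this]
  have hne : u i ≠ u j := fun h => hij'.ne (u.injective h)
  have c3 : twistedLT (insert (Equiv.swap a b) A) (Equiv.swap a b (u i)) (Equiv.swap a b (u j)) ↔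
      twistedLT A (u i) (u j) := by
    rw [c2 _ _ (by rw [Equiv.swap_apply_eq_iff, Equiv.swap_apply_eq_iff]; simp; tauto)
      (by rw [Equiv.swap_apply_eq_iff, Equiv.swap_apply_eq_iff]; simp; tauto)]
    generalize u i = x at *
    generalize u j = y at *
    rw [Equiv.swap_apply_def, Equiv.swap_apply_def]
    have := hl y
    have := hr x
    split_ifs <;> grind
  simp only [c1, c2 _ _ h1 h2, c3]
  ring

/-! ### Reflection orders and their initial sections. -/

namespace IsReflectionOrder

variable {prec : Equiv.Perm (Fin n) → Equiv.Perm (Fin n) → Prop}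

theorem irrefl (h : IsReflectionOrder prec) {s : Equiv.Perm (Fin n)} (hs : s.IsSwap) :
    ¬ prec s s :=
  h.total.irrefl ⟨s, hs⟩

theorem trans (h : IsReflectionOrder prec) {s t r : Equiv.Perm (Fin n)} (hs : s.IsSwap)
    (ht : t.IsSwap) (hr : r.IsSwap) (h1 : prec s t) (h2 : prec t r) : prec s r :=
  h.total.trans ⟨s, hs⟩ ⟨t, ht⟩ ⟨r, hr⟩ h1 h2

theorem asymm (h : IsReflectionOrder prec) {s t : Equiv.Perm (Fin n)} (hs : s.IsSwap)
    (ht : t.IsSwap) (h1 : prec s t) : ¬ prec t s :=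
  fun h2 => h.irrefl hs (h.trans hs ht hs h1 h2)

theorem trichotomy (h : IsReflectionOrder prec) {s t : Equiv.Perm (Fin n)} (hs : s.IsSwap)
    (ht : t.IsSwap) (hne : s ≠ t) : prec s t ∨ prec t s := by
  by_contra! hc
  exact hne (congrArg Subtype.val (h.total.trichotomous ⟨s, hs⟩ ⟨t, ht⟩ hc.1 hc.2))

theorem swap (h : IsReflectionOrder prec) : IsReflectionOrder fun s t => prec t s where
  total := by
    have := h.total
    exact inferInstanceAs (IsStrictTotalOrder _ (Function.swap fun s t :
      {t : Equiv.Perm (Fin n) // t.IsSwap} => prec s.1 t.1))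
  triple a b c hab hbc := (h.triple a b c hab hbc).symm.imp And.symm And.symm

/-- In either orientation of the triple, `(a b)` is an end, so the other two transpositions lie on
the same side of it. In `prec_iff_mid` it is the middle one and they lie on opposite sides. -/
theorem prec_iff_low (h : IsReflectionOrder prec) {x a b : Fin n} (hx : x < a) (hab : a < b) :
    prec (.swap x a) (.swap a b) ↔ prec (.swap x b) (.swap a b) := by
  have s1 : (Equiv.swap x a).IsSwap := ⟨_, _, hx.ne, rfl⟩
  have s2 : (Equiv.swap x b).IsSwap := ⟨_, _, (hx.trans hab).ne, rfl⟩
  have s3 : (Equiv.swap a b).IsSwap := ⟨_, _, hab.ne, rfl⟩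
  rcases h.triple x a b hx hab with ⟨h1, h2⟩ | ⟨h1, h2⟩
  · exact iff_of_true (h.trans s1 s2 s3 h1 h2) h2
  · exact iff_of_false (h.asymm s3 s1 (h.trans s3 s2 s1 h1 h2)) (h.asymm s3 s2 h1)

theorem prec_iff_high (h : IsReflectionOrder prec) {x a b : Fin n} (hx : b < x) (hab : a < b) :
    prec (.swap a x) (.swap a b) ↔ prec (.swap b x) (.swap a b) := by
  have s1 : (Equiv.swap b x).IsSwap := ⟨_, _, hx.ne, rfl⟩
  have s2 : (Equiv.swap a x).IsSwap := ⟨_, _, (hab.trans hx).ne, rfl⟩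
  have s3 : (Equiv.swap a b).IsSwap := ⟨_, _, hab.ne, rfl⟩
  rcases h.triple a b x hab hx with ⟨h1, h2⟩ | ⟨h1, h2⟩
  · exact iff_of_false (h.asymm s3 s2 h1) (h.asymm s3 s1 (h.trans s3 s2 s1 h1 h2))
  · exact iff_of_true h2 (h.trans s1 s2 s3 h1 h2)

theorem prec_iff_mid (h : IsReflectionOrder prec) {x a b : Fin n} (hx : a < x) (hxb : x < b) :
    prec (.swap a x) (.swap a b) ↔ ¬ prec (.swap x b) (.swap a b) := by
  have s1 : (Equiv.swap a x).IsSwap := ⟨_, _, hx.ne, rfl⟩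
  have s2 : (Equiv.swap x b).IsSwap := ⟨_, _, hxb.ne, rfl⟩
  have s3 : (Equiv.swap a b).IsSwap := ⟨_, _, (hx.trans hxb).ne, rfl⟩
  rcases h.triple a x b hx hxb with ⟨h1, h2⟩ | ⟨h1, h2⟩
  · exact iff_of_true h1 (h.asymm s3 s2 h2)
  · exact iff_of_false (h.asymm s3 s1 h2) (not_not.2 h1)

/-- Here `A` is, on transpositions, the initial section below `(a b)`. This and its mirror image
supply the non-separation hypotheses of `rightOp_raise`. -/
theorem twistedLT_left_iff (h : IsReflectionOrder prec) {A : Set (Equiv.Perm (Fin n))}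
    {a b x : Fin n} (hab : a < b)
    (hA : ∀ s : Equiv.Perm (Fin n), s.IsSwap → (s ∈ A ↔ prec s (.swap a b)))
    (hxa : x ≠ a) (hxb : x ≠ b) : twistedLT A a x ↔ twistedLT A b x := by
  have m1 : Equiv.swap a x ∈ A ↔ prec (.swap a x) (.swap a b) := hA _ ⟨_, _, hxa.symm, rfl⟩
  have m2 : Equiv.swap b x ∈ A ↔ prec (.swap b x) (.swap a b) := hA _ ⟨_, _, hxb.symm, rfl⟩
  rcases lt_or_gt_of_ne hxa with h1 | h1
  · have := h.prec_iff_low h1 hab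
    rw [Equiv.swap_comm x a, Equiv.swap_comm x b] at this
    simp [twistedLT, m1, m2, this, h1, h1.not_gt, h1.trans hab, (h1.trans hab).not_gt]
  rcases lt_or_gt_of_ne hxb with h2 | h2
  · have := h.prec_iff_mid h1 h2
    rw [Equiv.swap_comm x b] at this
    simp [twistedLT, m1, m2, this, h1, h1.not_gt, h2, h2.not_gt]
  · have := h.prec_iff_high h2 hab
    simp [twistedLT, m1, m2, this, h2, h1.not_gt, h1, h2.not_gt]

theorem twistedLT_right_iff (h : IsReflectionOrder prec) {A : Set (Equiv.Perm (Fin n))}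
    {a b x : Fin n} (hab : a < b)
    (hA : ∀ s : Equiv.Perm (Fin n), s.IsSwap → (s ∈ A ↔ prec s (.swap a b)))
    (hxa : x ≠ a) (hxb : x ≠ b) : twistedLT A x a ↔ twistedLT A x b := by
  have m1 : Equiv.swap x a ∈ A ↔ prec (.swap x a) (.swap a b) := hA _ ⟨_, _, hxa, rfl⟩
  have m2 : Equiv.swap x b ∈ A ↔ prec (.swap x b) (.swap a b) := hA _ ⟨_, _, hxb, rfl⟩
  rcases lt_or_gt_of_ne hxa with h1 | h1
  · have := h.prec_iff_low h1 hab
    simp [twistedLT, m1, m2, this, h1, h1.not_gt, h1.trans hab, (h1.trans hab).not_gt]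
  rcases lt_or_gt_of_ne hxb with h2 | h2
  · have := h.prec_iff_mid h1 h2
    rw [Equiv.swap_comm a x] at this
    simp [twistedLT, m1, m2, this, h1, h1.not_gt, h2, h2.not_gt]
  · have := h.prec_iff_high h2 hab
    rw [Equiv.swap_comm a x, Equiv.swap_comm b x] at this
    simp [twistedLT, m1, m2, this, h2, h1.not_gt, h1, h2.not_gt]

end IsReflectionOrder

/-! ### Passing the operators through the full list of transpositions. -/

variable {prec : Equiv.Perm (Fin n) → Equiv.Perm (Fin n) → Prop}
  {L : List (Equiv.Perm (Fin n))}

/-- `L` lists all transpositions in the order `prec`. -/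
structure Enumerates (prec : Equiv.Perm (Fin n) → Equiv.Perm (Fin n) → Prop)
    (L : List (Equiv.Perm (Fin n))) : Prop where
  mem_iff : ∀ t, t ∈ L ↔ t.IsSwap
  pairwise : L.Pairwise prec

open Classical in
theorem IsReflectionOrder.exists_enumerates (h : IsReflectionOrder prec) :
    ∃ L, Enumerates prec L := by
  have := h.total
  let := linearOrderOfSTO (fun s t : {t : Equiv.Perm (Fin n) // t.IsSwap} => prec s.1 t.1)
  refine ⟨((Finset.univ : Finset {t : Equiv.Perm (Fin n) // t.IsSwap}).sort (· ≤ ·)).map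
    Subtype.val, ?_, ?_⟩
  · intro t
    simp
  · rw [List.pairwise_map]
    exact (Finset.sortedLT_sort _).pairwise

theorem exists_swap_of_isSwap {t : Equiv.Perm (Fin n)} (ht : t.IsSwap) :
    ∃ a b, a < b ∧ t = Equiv.swap a b := by
  obtain ⟨a, b, hab, rfl⟩ := ht
  rcases lt_or_gt_of_ne hab with h | h
  · exact ⟨a, b, h, rfl⟩
  · exact ⟨b, a, h, Equiv.swap_comm _ _⟩

theorem rightOp_foldr_raise (h : IsReflectionOrder prec) (hL : Enumerates prec L)
    {i j : Fin n} (hij : i.val + 1 = j.val) (f : Equiv.Perm (Fin n) → ℤ[X])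
    (pre suf : List (Equiv.Perm (Fin n))) (hps : pre ++ suf = L) :
    rightOp (twistedLT {s | s ∈ pre}) i j (suf.foldr raise f) =
      suf.foldr raise (rightOp (twistedLT {s | s ∈ L}) i j f) := by
  induction suf generalizing pre with
  | nil => simp only [List.append_nil] at hps; subst hps; rfl
  | cons t suf ih =>
    have hsw : ∀ s, s ∈ pre ++ t :: suf ↔ s.IsSwap := by rw [hps]; exact hL.mem_iff
    have hpw : (pre ++ t :: suf).Pairwise prec := by rw [hps]; exact hL.pairwise
    rw [List.pairwise_append, List.pairwise_cons] at hpw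
    have ht : t.IsSwap := (hsw t).1 (by simp)
    have hA : ∀ s : Equiv.Perm (Fin n), s.IsSwap → (s ∈ {s | s ∈ pre} ↔ prec s t) := by
      intro s hs
      refine ⟨fun hm => hpw.2.2 s hm t (by simp), fun hp => ?_⟩
      rcases List.mem_append.1 ((hsw s).2 hs) with hm | hm
      · exact hm
      rcases List.mem_cons.1 hm with rfl | hm
      · exact absurd hp (h.irrefl hs)
      · exact absurd hp (h.asymm ht hs (hpw.2.1.1 s hm))
    have hins : {s | s ∈ pre ++ [t]} = insert t {s | s ∈ pre} := by
      ext s; simp [or_comm]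
    obtain ⟨a, b, hab, rfl⟩ := exists_swap_of_isSwap ht
    rw [List.foldr_cons, List.foldr_cons, rightOp_raise hab
      (fun hm => h.irrefl ht ((hA _ ht).1 hm)) (fun x => h.twistedLT_left_iff hab hA)
      (fun x => h.twistedLT_right_iff hab hA) hij, ← hins, ih _ (by simpa using hps)]

theorem rightOp_congr {r r' : Fin n → Fin n → Prop} (hr : ∀ x y, x ≠ y → (r x y ↔ r' x y))
    {i j : Fin n} (hij : i ≠ j) (f : Equiv.Perm (Fin n) → ℤ[X]) :
    rightOp r i j f = rightOp r' i j f := by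
  funext u
  simp only [rightOp, hr (u i) (u j) fun h => hij (u.injective h)]

/-- Twisting by the empty section gives `<`; twisting by all transpositions gives `>`. -/
theorem rightOp_lt_foldr_raise (h : IsReflectionOrder prec) (hL : Enumerates prec L)
    {i j : Fin n} (hij : i.val + 1 = j.val) (f : Equiv.Perm (Fin n) → ℤ[X]) :
    rightOp (· < ·) i j (L.foldr raise f) = L.foldr raise (rightOp (· > ·) i j f) := by
  have hne : i ≠ j := by rintro rfl; omega
  have := rightOp_foldr_raise h hL hij f [] L rfl
  rw [rightOp_congr (r := twistedLT {s | s ∈ []}) (r' := (· < ·)) _ hne,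
    rightOp_congr (r := twistedLT {s | s ∈ L}) (r' := (· > ·)) _ hne] at this
  · exact this
  · intro x y hxy
    have : Equiv.swap x y ∈ L := (hL.mem_iff _).2 ⟨x, y, hxy, rfl⟩
    simp [twistedLT, this]
  · intro x y hxy
    simp [twistedLT]

theorem rightOp_single {r : Fin n → Fin n → Prop} {i j : Fin n} {v : Equiv.Perm (Fin n)}
    (h : ¬ r (v i) (v j)) :
    rightOp r i j (Pi.single v 1) = Pi.single (v * Equiv.swap i j) 1 := by
  funext u
  have e : u * Equiv.swap i j = v ↔ u = v * Equiv.swap i j := by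
    rw [← eq_mul_inv_iff_mul_eq, Equiv.swap_inv]
  by_cases huv : u = v
  · subst huv
    simp only [rightOp, Pi.single_apply, e, indX_of_not h, zero_mul, add_zero]
  · simp only [rightOp, Pi.single_apply, e, if_neg huv, mul_zero, add_zero]

theorem leftOp_single {r : Fin n → Fin n → Prop} {i j : Fin n} {v : Equiv.Perm (Fin n)}
    (h : ¬ r (v⁻¹ i) (v⁻¹ j)) :
    leftOp r i j (Pi.single v 1) = Pi.single (Equiv.swap i j * v) 1 := by
  funext u
  have e : Equiv.swap i j * u = v ↔ u = Equiv.swap i j * v := by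
    rw [← eq_inv_mul_iff_mul_eq, Equiv.swap_inv]
  by_cases huv : u = v
  · subst huv
    simp only [leftOp, Pi.single_apply, e, indX_of_not h, zero_mul, add_zero]
  · simp only [leftOp, Pi.single_apply, e, if_neg huv, mul_zero, add_zero]

/-- The identity has length zero, so no edge ends there. -/
theorem foldr_raise_single_one (L : List (Equiv.Perm (Fin n))) :
    L.foldr raise (Pi.single 1 1) = Pi.single 1 1 := by
  induction L with
  | nil => rfl
  | cons t L ih =>
    rw [List.foldr_cons, ih]
    funext u
    by_cases h : t * u = 1
    · rw [raise, h, len_one, indX_of_not (Nat.not_lt_zero _), zero_mul, add_zero]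
    · simp [raise, Pi.single_apply, h]

theorem leftOp_single_one_eq_rightOp (i j : Fin n) :
    leftOp (· < ·) i j (Pi.single (1 : Equiv.Perm (Fin n)) (1 : ℤ[X])) =
      rightOp (· < ·) i j (Pi.single 1 1) := by
  funext u
  have e1 : Equiv.swap i j * u = 1 ↔ u = Equiv.swap i j := by
    rw [← eq_inv_mul_iff_mul_eq, Equiv.swap_inv, mul_one]
  have e2 : u * Equiv.swap i j = 1 ↔ u = Equiv.swap i j := by
    rw [← eq_mul_inv_iff_mul_eq, Equiv.swap_inv, one_mul]
  by_cases h : u = 1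
  · subst h; simp [leftOp, rightOp]
  · simp [leftOp, rightOp, Pi.single_apply, h, e1, e2]

/-- Every permutation is reached from `1` by multiplying on the right by ascents. -/
theorem ascent_induction {p : Equiv.Perm (Fin n) → Prop} (one : p 1)
    (step : ∀ v (i j : Fin n), i.val + 1 = j.val → v i < v j → p v → p (v * Equiv.swap i j))
    (v : Equiv.Perm (Fin n)) : p v := by
  induction hk : (inversions v⁻¹).card generalizing v with
  | zero =>
    by_cases h : v⁻¹ = 1
    · rw [inv_eq_one] at h; exact h ▸ one
    · obtain ⟨i, j, hij, hlt⟩ := exists_succ_lt_of_ne_one h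
      have := card_inversions_swap_succ_mul' hij hlt
      omega
  | succ k ih =>
    have h : v⁻¹ ≠ 1 := by rintro h; rw [h, card_inversions_one] at hk; omega
    obtain ⟨i, j, hij, hlt⟩ := exists_succ_lt_of_ne_one h
    have h1 := card_inversions_swap_succ_mul' hij hlt
    have := step (v * Equiv.swap i j) i j hij (by simpa using hlt) (ih _ (by
      rw [mul_inv_rev, Equiv.swap_inv]; omega))
    simpa [mul_assoc] using this

/-- Left multiplication conjugates the labels, so the factor-by-factor argument does not carry over.
Instead, right operators build the delta function at `v` from the one at `1`, and they commute with
left operators. -/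
theorem leftOp_lt_foldr_raise_single (h : IsReflectionOrder prec) (hL : Enumerates prec L)
    {i j : Fin n} (hij : i.val + 1 = j.val) (v : Equiv.Perm (Fin n)) :
    leftOp (· < ·) i j (L.foldr raise (Pi.single v 1)) =
      L.foldr raise (leftOp (· > ·) i j (Pi.single v 1)) := by
  have hij' : i < j := by rw [Fin.lt_def]; omega
  induction v using ascent_induction with
  | one =>
    rw [foldr_raise_single_one, leftOp_single (r := (· > ·)) (by simpa using hij'.le), mul_one,
      leftOp_single_one_eq_rightOp]
    have := rightOp_lt_foldr_raise h hL hij (Pi.single 1 1)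
    rw [foldr_raise_single_one, rightOp_single (r := (· > ·)) (by simpa using hij'.le), one_mul] at this
    exact this
  | step v k l hkl hv ih =>
    rw [← rightOp_single (r := (· > ·)) (by simpa using hv.le),
      ← rightOp_lt_foldr_raise h hL hkl, leftOp_rightOp_comm (Or.inl rfl) hij hkl, ih,
      rightOp_lt_foldr_raise h hL hkl, leftOp_rightOp_comm (Or.inr rfl) hij hkl]

/-! ### The path polynomial and its recursion. -/

/-- The generating polynomial of the paths from `u` to `v` in the Bruhat graph whose label
sequence is a sublist of `L`. -/
noncomputable def incPoly (L : List (Equiv.Perm (Fin n))) (u v : Equiv.Perm (Fin n)) : ℤ[X] :=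
  L.foldr raise (Pi.single v 1) u

/-- The exchange identity is used at `s v`: there the `>` operator has no `q`-term and just
translates the delta function to `v`. -/
theorem incPoly_rec (h : IsReflectionOrder prec) (hL : Enumerates prec L)
    {i j : Fin n} (hij : i.val + 1 = j.val) (u : Equiv.Perm (Fin n)) {v : Equiv.Perm (Fin n)}
    (hv : v⁻¹ j < v⁻¹ i) :
    incPoly L u v = incPoly L (Equiv.swap i j * u) (Equiv.swap i j * v) +
      indX (u⁻¹ i < u⁻¹ j) * incPoly L u (Equiv.swap i j * v) := by
  have := congrFun (leftOp_lt_foldr_raise_single h hL hij (Equiv.swap i j * v)) u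
  rw [leftOp_single (by simpa using hv.le), Equiv.swap_mul_self_mul] at this
  exact this.symm

theorem incPoly_one (L : List (Equiv.Perm (Fin n))) (u : Equiv.Perm (Fin n)) :
    incPoly L u 1 = if u = 1 then 1 else 0 := by
  rw [incPoly, foldr_raise_single_one, Pi.single_apply]

theorem BruhatLE.len_le {x y : Equiv.Perm (Fin n)} (h : BruhatLE x y) : len x ≤ len y := by
  induction h with
  | refl => exact le_rfl
  | tail _ h ih => exact ih.trans h.2.le

theorem BruhatLE.len_lt {x y : Equiv.Perm (Fin n)} (h : BruhatLE x y) (hne : x ≠ y) :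
    len x < len y := by
  rcases Relation.ReflTransGen.cases_head h with rfl | ⟨z, hz, hzy⟩
  · exact absurd rfl hne
  · exact hz.2.trans_le (BruhatLE.len_le hzy)

theorem len_lt_len_swap_succ_mul_iff {i j : Fin n} (hij : i.val + 1 = j.val)
    {w : Equiv.Perm (Fin n)} : len w < len (Equiv.swap i j * w) ↔ w⁻¹ i < w⁻¹ j :=
  len_lt_len_swap_mul_iff (by rw [Fin.lt_def]; omega)

theorem len_swap_succ_mul_lt_len_iff {i j : Fin n} (hij : i.val + 1 = j.val)
    {w : Equiv.Perm (Fin n)} : len (Equiv.swap i j * w) < len w ↔ w⁻¹ j < w⁻¹ i := by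
  have := len_lt_len_swap_succ_mul_iff hij (w := Equiv.swap i j * w)
  rwa [Equiv.swap_mul_self_mul, mul_inv_rev, Equiv.swap_inv, Equiv.Perm.mul_apply,
    Equiv.Perm.mul_apply, Equiv.swap_apply_left, Equiv.swap_apply_right] at this

theorem bruhatLT_swap_mul {i j : Fin n} (hij : i.val + 1 = j.val)
    {w : Equiv.Perm (Fin n)} (h : len (Equiv.swap i j * w) < len w) :
    BruhatLT (Equiv.swap i j * w) w := by
  refine ⟨Relation.ReflTransGen.single ⟨⟨i, j, ?_, by simp⟩, h⟩, fun he => ?_⟩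
  · rintro rfl; omega
  · rw [he] at h; exact lt_irrefl _ h

theorem bruhatLE_of_incPoly_ne_zero (hL : ∀ t ∈ L, t.IsSwap) {u v : Equiv.Perm (Fin n)}
    (h : incPoly L u v ≠ 0) : BruhatLE u v := by
  induction L generalizing u with
  | nil =>
    have : u = v := by
      by_contra hne
      simp [incPoly, hne] at h
    exact this ▸ Relation.ReflTransGen.refl
  | cons t L ih =>
    have hL' : ∀ t ∈ L, t.IsSwap := fun s hs => hL s (by simp [hs])
    by_cases h1 : incPoly L u v = 0
    · by_cases h2 : len u < len (t * u) ∧ incPoly L (t * u) v ≠ 0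
      · exact Relation.ReflTransGen.head ⟨by simpa using hL t (by simp), h2.1⟩ (ih hL' h2.2)
      · refine absurd ?_ h
        change incPoly L u v + indX _ * incPoly L (t * u) v = 0
        rw [h1, zero_add]
        by_cases h3 : len u < len (t * u)
        · rw [not_not.1 fun h4 => h2 ⟨h3, h4⟩, mul_zero]
        · rw [indX_of_not h3, zero_mul]
    · exact ih hL' h1

theorem incPoly_eq_zero (hL : ∀ t ∈ L, t.IsSwap) {u v : Equiv.Perm (Fin n)}
    (h : ¬ BruhatLE u v) : incPoly L u v = 0 :=
  not_not.1 fun h' => h (bruhatLE_of_incPoly_ne_zero hL h')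

theorem incPoly_self (hL : ∀ t ∈ L, t.IsSwap) (u : Equiv.Perm (Fin n)) :
    incPoly L u u = 1 := by
  induction L with
  | nil => simp [incPoly]
  | cons t L ih =>
    have hL' : ∀ t ∈ L, t.IsSwap := fun s hs => hL s (by simp [hs])
    change incPoly L u u + indX _ * incPoly L (t * u) u = 1
    by_cases h : len u < len (t * u)
    · rw [ih hL', incPoly_eq_zero hL' fun hle => h.not_ge (BruhatLE.len_le hle), mul_zero,
        add_zero]
    · rw [ih hL', indX_of_not h, zero_mul, add_zero]

/-! ### From `R` to `R̃`. -/

open LaurentPolynomial in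
theorem aeval_T_two_injective : Function.Injective
    (aeval (T 2 : LaurentPolynomial ℤ) : ℤ[X] → LaurentPolynomial ℤ) := by
  have : (aeval (T 2 : LaurentPolynomial ℤ) : ℤ[X] →ₐ[ℤ] LaurentPolynomial ℤ) =
      toLaurentAlg.comp (expand ℤ 2) := by
    apply Polynomial.algHom_ext
    rw [aeval_X, AlgHom.comp_apply, expand_X, toLaurentAlg_apply, toLaurent_X_pow]
    rfl
  intro p q h
  rw [this, AlgHom.comp_apply, AlgHom.comp_apply] at h
  exact expand_injective two_pos (toLaurent_injective h)

-- A polynomial in the kernel vanishes at `m + 1 - 1/(m + 1)` for every natural `m`, hence at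
-- infinitely many reals.
open LaurentPolynomial in
theorem aeval_T_sub_T_inv_injective : Function.Injective
    (aeval (T 1 - T (-1) : LaurentPolynomial ℤ) : ℤ[X] → LaurentPolynomial ℤ) := by
  rw [injective_iff_map_eq_zero]
  intro p hp
  have key : ∀ m : ℕ, (p.map (Int.castRingHom ℝ)).IsRoot ((m + 1 : ℝ) - (m + 1 : ℝ)⁻¹) := by
    intro m
    have hm : (m + 1 : ℝ) ≠ 0 := by positivity
    have := congrArg (LaurentPolynomial.eval₂ (Int.castRingHom ℝ) (Units.mk0 (m + 1 : ℝ) hm)) hp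
    rw [aeval_def, Polynomial.hom_eval₂, map_sub, map_zero] at this
    rw [RingHom.ext_int (RingHom.comp _ _) (Int.castRingHom ℝ), LaurentPolynomial.eval₂_T,
      LaurentPolynomial.eval₂_T] at this
    rw [IsRoot, eval_map]
    simpa using this
  have : p.map (Int.castRingHom ℝ) = 0 := by
    refine Polynomial.eq_zero_of_infinite_isRoot _ (Set.Infinite.mono ?_
      (Set.infinite_range_of_injective
        (f := fun m : ℕ => (m + 1 : ℝ) - (m + 1 : ℝ)⁻¹) (StrictMono.injective ?_)))
    · rintro _ ⟨m, rfl⟩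
      exact key m
    · intro a b hab
      have h1 : (a + 1 : ℝ) < b + 1 := by exact_mod_cast Nat.succ_lt_succ hab
      have h2 : (b + 1 : ℝ)⁻¹ < (a + 1 : ℝ)⁻¹ := inv_strictAnti₀ (by positivity) h1
      simp only
      linarith
  exact (Polynomial.map_eq_zero_iff Int.cast_injective).1 this

/-- The identity relating `R`-polynomials and `R̃`-polynomials. -/
def Normalizes (d : ℤ) (r p : ℤ[X]) : Prop :=
  aeval (LaurentPolynomial.T 2 : LaurentPolynomial ℤ) r = LaurentPolynomial.T d *
    aeval (LaurentPolynomial.T 1 - LaurentPolynomial.T (-1) : LaurentPolynomial ℤ) p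

theorem Normalizes.zero (d : ℤ) : Normalizes d 0 0 := by simp [Normalizes]

theorem Normalizes.one : Normalizes 0 1 1 := by simp [Normalizes]

-- With `q = T²` one has `q - 1 = T (T - T⁻¹)`; this turns the `R`-recursion into the
-- `R̃`-recursion.
open LaurentPolynomial in
theorem Normalizes.step {d : ℤ} {r₁ p₁ r₂ p₂ : ℤ[X]} (h₁ : Normalizes (d - 1) r₁ p₁)
    (h₂ : Normalizes (d - 2) r₂ p₂) : Normalizes d ((X - 1) * r₁ + X * r₂) (p₂ + X * p₁) := by
  unfold Normalizes at *
  simp only [map_add, map_mul, map_sub, aeval_X, h₁, h₂, mul_add, mul_sub, sub_mul,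
    one_mul, ← mul_assoc, ← T_add]
  ring_nf

/-- For arbitrary `p`, `T^d p(T - T⁻¹)` need not be a polynomial in `T²`, so `r` is built along the
recursion. -/
theorem exists_normalizes (h : IsReflectionOrder prec) (hL : Enumerates prec L)
    (u v : Equiv.Perm (Fin n)) : ∃ r, Normalizes (len v - len u) r (incPoly L u v) := by
  induction hk : len v generalizing u v with
  | zero =>
    have hv : v = 1 := by
      by_contra hne
      have := len_pos_of_ne_one hne
      omega
    subst hv
    rw [incPoly_one]
    split_ifs with hu
    · subst hu; exact ⟨1, by simpa [len_one] using Normalizes.one⟩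
    · exact ⟨0, Normalizes.zero _⟩
  | succ k ih =>
    have hv : v ≠ 1 := by rintro rfl; rw [len_one] at hk; omega
    obtain ⟨i, j, hij, hlt⟩ := exists_succ_lt_of_ne_one hv
    have hlv := len_swap_succ_mul' hij hlt
    have hlv' : len (Equiv.swap i j * v) = k := by omega
    rw [incPoly_rec h hL hij u hlt]
    obtain ⟨r₂, h₂⟩ := ih (Equiv.swap i j * u) (Equiv.swap i j * v) hlv'
    obtain ⟨r₁, h₁⟩ := ih u (Equiv.swap i j * v) hlv'
    by_cases hu : u⁻¹ i < u⁻¹ j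
    · refine ⟨_, indX_of hu ▸ Normalizes.step (r₁ := r₁) (r₂ := r₂) ?_ ?_⟩
      · convert h₁ using 1; push_cast; ring
      · rw [len_swap_succ_mul hij hu] at h₂
        convert h₂ using 1; push_cast; ring
    · refine ⟨r₂, ?_⟩
      have hne : u⁻¹ j ≠ u⁻¹ i := fun h => by
        have := (u⁻¹).injective h
        subst this; omega
      have := len_swap_succ_mul' hij (lt_of_le_of_ne (not_lt.1 hu) hne)
      rw [indX_of_not hu, zero_mul, add_zero]
      convert h₂ using 1
      rw [← this]; push_cast; ring

/-- `R` is chosen by `Classical.epsilon`, so its defining properties become available only once some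
family exists. -/
theorem exists_isRFamily (h : IsReflectionOrder prec) (hL : Enumerates prec L) :
    ∃ R : Equiv.Perm (Fin n) → Equiv.Perm (Fin n) → ℤ[X], IsRFamily R := by
  choose R hR using exists_normalizes h hL
  have hsw : ∀ t ∈ L, t.IsSwap := fun t => (hL.mem_iff t).1
  refine ⟨R, ⟨fun u v huv => ?_, fun u => ?_, fun u v s huv hs hv hu => ?_,
    fun u v s huv hs hv hu => ?_⟩⟩
  · have := hR u v
    rw [incPoly_eq_zero hsw huv] at this
    exact aeval_T_two_injective (this.trans (by simp))
  · have := hR u u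
    rw [incPoly_self hsw, sub_self] at this
    exact aeval_T_two_injective (this.trans Normalizes.one.symm)
  · obtain ⟨i, j, hij, rfl⟩ := isSimple_iff.1 hs
    have hv' := (len_swap_succ_mul_lt_len_iff hij).1 (hv.1.len_lt hv.2)
    have hu' := (len_swap_succ_mul_lt_len_iff hij).1 (hu.1.len_lt hu.2)
    have h1 := hR u v
    have h2 := hR (Equiv.swap i j * u) (Equiv.swap i j * v)
    rw [incPoly_rec h hL hij u hv', indX_of_not hu'.not_gt, zero_mul, add_zero] at h1
    rw [← len_swap_succ_mul' hij hu', ← len_swap_succ_mul' hij hv'] at h1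
    refine aeval_T_two_injective (h1.trans (Eq.trans ?_ h2.symm))
    congr 2
    push_cast; ring
  · obtain ⟨i, j, hij, rfl⟩ := isSimple_iff.1 hs
    have hv' := (len_swap_succ_mul_lt_len_iff hij).1 (hv.1.len_lt hv.2)
    have hu' := (len_lt_len_swap_succ_mul_iff hij).1 (hu.1.len_lt hu.2)
    have h1 := hR u v
    have h2 := hR (Equiv.swap i j * u) (Equiv.swap i j * v)
    have h3 := hR u (Equiv.swap i j * v)
    rw [incPoly_rec h hL hij u hv', indX_of hu'] at h1
    rw [len_swap_succ_mul hij hu'] at h2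
    have e := len_swap_succ_mul' hij hv'
    refine aeval_T_two_injective (h1.trans (Normalizes.step ?_ ?_).symm)
    · convert h3 using 1; rw [← e]; push_cast; ring
    · convert h2 using 1; rw [← e]; push_cast; ring

theorem IsRFamily.normalizes (h : IsReflectionOrder prec) (hL : Enumerates prec L)
    {R : Equiv.Perm (Fin n) → Equiv.Perm (Fin n) → ℤ[X]} (hR : IsRFamily R)
    (u v : Equiv.Perm (Fin n)) : Normalizes (len v - len u) (R u v) (incPoly L u v) := by
  have hsw : ∀ t ∈ L, t.IsSwap := fun t => (hL.mem_iff t).1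
  induction hk : len v using Nat.strong_induction_on generalizing u v with
  | _ k ih =>
  subst hk
  by_cases hle : BruhatLE u v
  swap
  · rw [hR.zero u v hle, incPoly_eq_zero hsw hle]; exact Normalizes.zero _
  by_cases huv : u = v
  · subst huv
    rw [hR.one, incPoly_self hsw, sub_self]; exact Normalizes.one
  have hv : v ≠ 1 := by
    rintro rfl
    have := hle.len_lt huv
    rw [len_one] at this
    omega
  obtain ⟨i, j, hij, hlt⟩ := exists_succ_lt_of_ne_one hv
  have e := len_swap_succ_mul' hij hlt
  have hs : IsSimple (Equiv.swap i j) := isSimple_iff.2 ⟨i, j, hij, rfl⟩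
  have hsv := bruhatLT_swap_mul hij (w := v) (by omega)
  have h2 := ih _ (by omega) (Equiv.swap i j * u) (Equiv.swap i j * v) rfl
  have h1 := ih _ (by omega) u (Equiv.swap i j * v) rfl
  rw [incPoly_rec h hL hij u hlt]
  by_cases hu : u⁻¹ i < u⁻¹ j
  · have e' := len_swap_succ_mul hij hu
    have hsu := bruhatLT_swap_mul hij (w := Equiv.swap i j * u) (by
      rw [Equiv.swap_mul_self_mul]; omega)
    rw [Equiv.swap_mul_self_mul] at hsu
    rw [hR.ascent u v _ ⟨hle, huv⟩ hs hsv hsu, indX_of hu]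
    refine Normalizes.step ?_ ?_
    · convert h1 using 1; rw [← e]; push_cast; ring
    · convert h2 using 1; rw [← e, e']; push_cast; ring
  · have hne : u⁻¹ j ≠ u⁻¹ i := fun h => by
      have := (u⁻¹).injective h
      subst this; omega
    have e' := len_swap_succ_mul' hij (lt_of_le_of_ne (not_lt.1 hu) hne)
    rw [hR.descent u v _ ⟨hle, huv⟩ hs hsv (bruhatLT_swap_mul hij (by omega)), indX_of_not hu,
      zero_mul, add_zero]
    convert h2 using 1
    rw [← e, ← e']; push_cast; ring

theorem rTilde_eq_incPoly (h : IsReflectionOrder prec) (hL : Enumerates prec L)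
    (u v : Equiv.Perm (Fin n)) : RTilde u v = incPoly L u v := by
  have hR : IsRFamily (R (n := n)) := Classical.epsilon_spec (exists_isRFamily h hL)
  have h1 : IsRTilde u v (incPoly L u v) := hR.normalizes h hL u v
  have h2 : IsRTilde u v (RTilde u v) := Classical.epsilon_spec ⟨_, h1⟩
  exact aeval_T_sub_T_inv_injective
    ((LaurentPolynomial.isUnit_T _).mul_left_cancel (h2.symm.trans h1))

/-- Colexicographic order puts `{a, b}`, `{a, c}`, `{b, c}` in this sequence. An order is needed
even for the first claim, which mentions none. -/
theorem exists_isReflectionOrder (n : ℕ) :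
    ∃ prec : Equiv.Perm (Fin n) → Equiv.Perm (Fin n) → Prop, IsReflectionOrder prec := by
  refine ⟨fun s t => toColex s.support < toColex t.support, ⟨?_, fun a b c hab hbc => ?_⟩⟩
  · have hinj : Function.Injective fun s : {t : Equiv.Perm (Fin n) // t.IsSwap} =>
        toColex s.1.support := by
      rintro ⟨s, hs⟩ ⟨t, ht⟩ hst
      obtain ⟨a, b, hab, rfl⟩ := exists_swap_of_isSwap hs
      obtain ⟨c, d, hcd, rfl⟩ := exists_swap_of_isSwap ht
      have : ({a, b} : Finset (Fin n)) = {c, d} := by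
        simpa [Equiv.Perm.support_swap hab.ne, Equiv.Perm.support_swap hcd.ne] using hst
      simp only [Subtype.mk.injEq]
      rw [swap_eq_swap_iff hcd.ne]
      rwa [← Finset.coe_inj, Finset.coe_pair, Finset.coe_pair, Set.pair_eq_pair_iff] at this
    exact {
      irrefl := fun s => lt_irrefl _
      trans := fun _ _ _ => lt_trans
      trichotomous := fun s t h1 h2 => hinj (le_antisymm (not_lt.1 h2) (not_lt.1 h1)) }
  · left
    have hac := hab.trans hbc
    rw [Equiv.Perm.support_swap hab.ne, Equiv.Perm.support_swap hac.ne,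
      Equiv.Perm.support_swap hbc.ne]
    constructor <;>
    · rw [Finset.Colex.toColex_lt_toColex]
      refine ⟨fun he => ?_, by
        simp only [Finset.mem_insert, Finset.mem_singleton, exists_eq_or_imp, exists_eq_left]
        grind⟩
      have h1 := Finset.ext_iff.1 he a
      have h2 := Finset.ext_iff.1 he b
      simp only [Finset.mem_insert, Finset.mem_singleton] at h1 h2
      grind

/-! ### Paths and Dyer's formula. -/

theorem IsPath.ne_nil {u v : Equiv.Perm (Fin n)} {γ : List (Equiv.Perm (Fin n))}
    (h : IsPath u v γ) : γ ≠ [] := by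
  rintro rfl
  simpa using h.2.1

theorem isPath_cons_iff {u v x : Equiv.Perm (Fin n)} {γ : List (Equiv.Perm (Fin n))} :
    IsPath u v (x :: γ) ↔ x = u ∧ ((γ = [] ∧ u = v) ∨ ∃ y, Edge u y ∧ IsPath y v γ) := by
  cases γ with
  | nil => simp [IsPath]; grind
  | cons y γ =>
    simp only [IsPath, List.isChain_cons_cons, List.head?_cons, List.getLast?_cons_cons]
    grind

theorem IsPath.bruhatLE {u v : Equiv.Perm (Fin n)} {γ : List (Equiv.Perm (Fin n))}
    (h : IsPath u v γ) : BruhatLE u v := by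
  induction γ generalizing u with
  | nil => exact absurd rfl h.ne_nil
  | cons x γ ih =>
    obtain ⟨rfl, ⟨rfl, rfl⟩ | ⟨y, hxy, hy⟩⟩ := isPath_cons_iff.1 h
    · exact Relation.ReflTransGen.refl
    · exact Relation.ReflTransGen.head hxy (ih hy)

theorem isPath_append_iff {u v x : Equiv.Perm (Fin n)} {α β : List (Equiv.Perm (Fin n))} :
    IsPath u v (α ++ x :: β) ↔ IsPath u x (α ++ [x]) ∧ IsPath x v (x :: β) := by
  unfold IsPath
  rw [List.isChain_split]
  cases α <;> cases β <;> simp <;> grind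

theorem finite_setOf_isPath (u v : Equiv.Perm (Fin n)) : {γ | IsPath u v γ}.Finite := by
  refine (List.finite_length_le (Equiv.Perm (Fin n))
    (Fintype.card (Equiv.Perm (Fin n)))).subset ?_
  rintro γ ⟨h, -⟩
  have h1 : γ.IsChain (fun x y => len x < len y) := h.imp fun _ _ h => h.2
  have h2 : (γ.map len).IsChain (· < ·) := (List.isChain_map len).2 h1
  exact List.Nodup.length_le_card (List.Nodup.of_map len (h2.pairwise.imp fun h => ne_of_lt h))

/-- The finite set of all paths from `u` to `v` in the Bruhat graph. -/
noncomputable def paths (u v : Equiv.Perm (Fin n)) : Finset (List (Equiv.Perm (Fin n))) :=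
  (finite_setOf_isPath u v).toFinset

theorem mem_paths {u v : Equiv.Perm (Fin n)} {γ : List (Equiv.Perm (Fin n))} :
    γ ∈ paths u v ↔ IsPath u v γ := by
  simp [paths]

theorem labels_cons_cons (x y : Equiv.Perm (Fin n)) (γ : List (Equiv.Perm (Fin n))) :
    labels (x :: y :: γ) = (y * x⁻¹) :: labels (y :: γ) := rfl

theorem length_labels (γ : List (Equiv.Perm (Fin n))) : (labels γ).length = γ.length - 1 := by
  simp [labels]

theorem labels_take (γ : List (Equiv.Perm (Fin n))) (i : ℕ) :
    labels (γ.take (i + 1)) = (labels γ).take i := by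
  induction γ generalizing i with
  | nil => simp [labels]
  | cons x γ ih =>
    cases γ with
    | nil => simp [labels]
    | cons y γ =>
      cases i with
      | zero => simp [labels]
      | succ i => rw [List.take_succ_cons, List.take_succ_cons, labels_cons_cons,
          labels_cons_cons, List.take_succ_cons, ← List.take_succ_cons, ih]

theorem labels_drop (γ : List (Equiv.Perm (Fin n))) (i : ℕ) :
    labels (γ.drop i) = (labels γ).drop i := by
  simp [labels, List.drop_zipWith]

theorem IsPath.isSwap_of_mem_labels {u v : Equiv.Perm (Fin n)} {γ : List (Equiv.Perm (Fin n))}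
    (h : IsPath u v γ) {t : Equiv.Perm (Fin n)} (ht : t ∈ labels γ) : t.IsSwap := by
  induction γ generalizing u with
  | nil => exact absurd rfl h.ne_nil
  | cons x γ ih =>
    obtain ⟨rfl, ⟨rfl, rfl⟩ | ⟨y, hxy, hy⟩⟩ := isPath_cons_iff.1 h
    · simp [labels] at ht
    · cases γ with
      | nil => exact absurd rfl hy.ne_nil
      | cons z γ =>
        obtain rfl : z = y := (isPath_cons_iff.1 hy).1
        rw [labels_cons_cons, List.mem_cons] at ht
        rcases ht with rfl | ht
        · exact hxy.1
        · exact ih hy ht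

-- The two terms of `raise t` separate the paths that avoid the label `t` from those that start with
-- it; `Nodup` makes the cases disjoint.
open Classical in
theorem incPoly_eq_sum_sublist (hL : ∀ t ∈ L, t.IsSwap) (hn : L.Nodup)
    (u v : Equiv.Perm (Fin n)) :
    incPoly L u v = ∑ γ ∈ paths u v with (labels γ).Sublist L, X ^ pathLength γ := by
  induction L generalizing u with
  | nil =>
    have e : (paths u v).filter (fun γ => (labels γ).Sublist []) = if u = v then {[u]} else ∅ := by
      ext γ
      rw [Finset.mem_filter, mem_paths, List.sublist_nil, ← List.length_eq_zero_iff,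
        length_labels]
      constructor
      · rintro ⟨h, hγ⟩
        match γ, h with
        | [], h => exact absurd rfl h.ne_nil
        | [x], h =>
          obtain ⟨rfl, ⟨-, rfl⟩ | ⟨y, -, hy⟩⟩ := isPath_cons_iff.1 h
          · simp
          · exact absurd rfl hy.ne_nil
      · split_ifs with huv
        · rw [Finset.mem_singleton]
          rintro rfl
          exact ⟨isPath_cons_iff.2 ⟨rfl, Or.inl ⟨rfl, huv⟩⟩, rfl⟩
        · simp
    rw [e]
    split_ifs with huv <;> simp [incPoly, huv, pathLength]
  | cons t L ih =>
    rw [List.nodup_cons] at hn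
    have hL' : ∀ t ∈ L, t.IsSwap := fun s hs => hL s (by simp [hs])
    change incPoly L u v + indX (len u < len (t * u)) * incPoly L (t * u) v = _
    have e : (paths u v).filter (fun γ => (labels γ).Sublist (t :: L)) =
        (paths u v).filter (fun γ => (labels γ).Sublist L) ∪
          (paths u v).filter (fun γ => ∃ r, labels γ = t :: r ∧ r.Sublist L) := by
      ext γ
      simp only [Finset.mem_filter, Finset.mem_union, List.sublist_cons_iff]
      tauto
    have hdisj : Disjoint ((paths u v).filter (fun γ => (labels γ).Sublist L))
        ((paths u v).filter (fun γ => ∃ r, labels γ = t :: r ∧ r.Sublist L)) := by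
      rw [Finset.disjoint_left]
      simp only [Finset.mem_filter, not_and, not_exists]
      rintro γ ⟨-, h⟩ - r hr
      rw [hr] at h
      exact absurd (h.subset (by simp)) hn.1
    rw [e, Finset.sum_union hdisj, ← ih hL' hn.2]
    congr 1
    by_cases hlt : len u < len (t * u)
    · have e2 : (paths u v).filter (fun γ => ∃ r, labels γ = t :: r ∧ r.Sublist L) =
          ((paths (t * u) v).filter (fun γ => (labels γ).Sublist L)).image (u :: ·) := by
        ext γ
        simp only [Finset.mem_filter, Finset.mem_image, mem_paths]
        constructor
        · rintro ⟨h, r, hr, hrL⟩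
          match γ, h with
          | [], h => exact absurd rfl h.ne_nil
          | [x], h => simp [labels] at hr
          | x :: y :: γ, h =>
            obtain ⟨rfl, ⟨h, -⟩ | ⟨z, hxz, hz⟩⟩ := isPath_cons_iff.1 h
            · simp at h
            obtain rfl := (isPath_cons_iff.1 hz).1
            rw [labels_cons_cons, List.cons.injEq] at hr
            obtain ⟨rfl, rfl⟩ := hr
            exact ⟨_, ⟨by simpa using hz, hrL⟩, rfl⟩
        · rintro ⟨γ, ⟨h, hs⟩, rfl⟩
          match γ, h with
          | [], h => exact absurd rfl h.ne_nil
          | x :: γ, h =>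
            obtain rfl := (isPath_cons_iff.1 h).1
            refine ⟨isPath_cons_iff.2 ⟨rfl, Or.inr ⟨_, ⟨?_, hlt⟩, h⟩⟩, _, ?_, hs⟩
            · simpa using hL t (by simp)
            · rw [labels_cons_cons, mul_inv_cancel_right]
      rw [e2, Finset.sum_image (fun _ _ _ _ h => (List.cons.inj h).2), indX_of hlt, ih hL' hn.2,
        Finset.mul_sum]
      refine Finset.sum_congr rfl fun γ hγ => ?_
      have := (mem_paths.1 (Finset.mem_filter.1 hγ).1).ne_nil
      cases γ with
      | nil => exact absurd rfl this
      | cons x γ => simp [pathLength, pow_succ, mul_comm]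
    · rw [indX_of_not hlt, zero_mul, eq_comm]
      refine Finset.sum_eq_zero fun γ hγ => ?_
      rw [Finset.mem_filter, mem_paths] at hγ
      obtain ⟨h, r, hr, -⟩ := hγ
      match γ, h with
      | [], h => exact absurd rfl h.ne_nil
      | [x], h => simp [labels] at hr
      | x :: y :: γ, h =>
        obtain ⟨rfl, ⟨h, -⟩ | ⟨z, hxz, hz⟩⟩ := isPath_cons_iff.1 h
        · simp at h
        obtain rfl := (isPath_cons_iff.1 hz).1
        rw [labels_cons_cons, List.cons.injEq] at hr
        refine absurd ?_ hlt
        rw [← hr.1]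
        simpa using hxz.2

theorem sublist_of_pairwise {α : Type*} {r : α → α → Prop} {l L : List α}
    (hr : ∀ s ∈ L, ∀ t ∈ L, r s t → ¬ r t s) (hsub : l ⊆ L) (hl : l.Pairwise r)
    (hL : L.Pairwise r) : l.Sublist L := by
  induction L generalizing l with
  | nil => rw [List.subset_nil] at hsub; rw [hsub]
  | cons t L ih =>
    have hr' : ∀ s ∈ L, ∀ t ∈ L, r s t → ¬ r t s := fun s hs t ht =>
      hr s (by simp [hs]) t (by simp [ht])
    rw [List.pairwise_cons] at hL
    cases l with
    | nil => simp
    | cons s l =>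
      rw [List.pairwise_cons] at hl
      have aux : ∀ l', l' ⊆ t :: L → (t ∉ l') → l' ⊆ L := fun l' h1 h2 x hx =>
        (List.mem_cons.1 (h1 hx)).resolve_left fun h => h2 (h ▸ hx)
      have hs : s ∈ t :: L := hsub (by simp)
      by_cases hst : s = t
      · subst hst
        refine (ih hr' (aux _ (fun x hx => hsub (by simp [hx])) fun hm => ?_) hl.2 hL.2).cons_cons s
        have := hl.1 _ hm
        exact hr s hs s hs this this
      · refine (ih hr' (aux _ hsub fun hm => ?_) (List.pairwise_cons.2 hl) hL.2).cons t
        have hm' := (List.mem_cons.1 hm).resolve_left (Ne.symm hst)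
        have hs' := (List.mem_cons.1 hs).resolve_left hst
        exact hr s hs t (by simp) (hl.1 _ hm') (hL.1 _ hs')

theorem IsReflectionOrder.pairwise_of_isChain (h : IsReflectionOrder prec)
    {l : List (Equiv.Perm (Fin n))} (hl : ∀ t ∈ l, t.IsSwap) (hc : l.IsChain prec) :
    l.Pairwise prec := by
  let r : Equiv.Perm (Fin n) → Equiv.Perm (Fin n) → Prop :=
    fun s t => s.IsSwap ∧ t.IsSwap ∧ prec s t
  -- Transitivity of `prec` is known only on transpositions, hence the restricted relation `r`.
  have : Trans r r r := ⟨fun h1 h2 => ⟨h1.1, h2.2.1, h.trans h1.1 h1.2.1 h2.2.1 h1.2.2 h2.2.2⟩⟩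
  have hr : l.IsChain r := hc.imp_of_mem_imp fun s t hs ht hst => ⟨hl s hs, hl t ht, hst⟩
  exact hr.pairwise.imp fun h => h.2.2

open Classical in
/-- Dyer's formula for the `R̃`-polynomials. -/
theorem rTilde_eq_sum_increasing (h : IsReflectionOrder prec) (u v : Equiv.Perm (Fin n)) :
    RTilde u v = ∑ γ ∈ paths u v with Increasing prec γ, X ^ pathLength γ := by
  obtain ⟨L, hL⟩ := h.exists_enumerates
  have hsw : ∀ t ∈ L, t.IsSwap := fun t => (hL.mem_iff t).1
  have hn : L.Nodup := by
    refine List.Pairwise.imp_of_mem (fun {s t} hs ht hst => ?_) hL.pairwise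
    rintro rfl
    exact h.irrefl (hsw _ hs) hst
  rw [rTilde_eq_incPoly h hL, incPoly_eq_sum_sublist hsw hn]
  refine Finset.sum_congr (Finset.filter_congr fun γ hγ => ?_) fun _ _ => rfl
  have hlab := fun t => (mem_paths.1 hγ).isSwap_of_mem_labels (t := t)
  constructor
  · exact fun hs => (hL.pairwise.sublist hs).isChain
  · exact fun hc => sublist_of_pairwise (fun s hs t ht => h.asymm (hsw s hs) (hsw t ht))
      (fun t ht => (hL.mem_iff t).2 (hlab t ht)) (h.pairwise_of_isChain hlab hc) hL.pairwise

open Classical in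
theorem rTilde_eq_sum_decreasing (h : IsReflectionOrder prec) (u v : Equiv.Perm (Fin n)) :
    RTilde u v = ∑ γ ∈ paths u v with Decreasing prec γ, X ^ pathLength γ :=
  rTilde_eq_sum_increasing h.swap u v

/-! ### Paths with a marked vertex or edge. -/

variable {I : Finset (Equiv.Perm (Fin n))} {u v : Equiv.Perm (Fin n)} {γ : List (Equiv.Perm (Fin n))}

theorem IsPath.exists_eq_append (h : IsPath u v γ) : ∃ δ, γ = δ ++ [v] := by
  obtain ⟨δ, y, rfl⟩ := γ.eq_nil_or_concat.resolve_left h.ne_nil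
  rw [List.concat_eq_append] at h ⊢
  obtain rfl : y = v := by simpa using h.2.2
  exact ⟨δ, rfl⟩

theorem IsPath.exists_eq_cons (h : IsPath u v γ) : ∃ ε, γ = u :: ε := by
  cases γ with
  | nil => exact absurd rfl h.ne_nil
  | cons z ε => exact ⟨ε, by rw [(isPath_cons_iff.1 h).1]⟩

theorem exists_append_cons_of_lt_length {α : Type*} {l : List α} {i : ℕ} (hi : i < l.length) :
    ∃ l₁ x l₂, l = l₁ ++ x :: l₂ ∧ l₁.length = i :=
  ⟨l.take i, l[i], l.drop (i + 1), by simp, by simp; omega⟩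

open Classical in
/-- Summing over pairs of composable paths with middle vertex in `I` amounts to summing over paths
with a marked vertex in `I`. -/
theorem sum_paths_mul_eq (I : Finset (Equiv.Perm (Fin n))) (u v : Equiv.Perm (Fin n))
    (F : List (Equiv.Perm (Fin n)) → List (Equiv.Perm (Fin n)) → ℤ[X]) :
    ∑ x ∈ I, ∑ δ ∈ paths u x, ∑ ε ∈ paths x v, F δ ε =
      ∑ γ ∈ paths u v, ∑ i ∈ Finset.range γ.length,
        if γ.getD i 1 ∈ I then F (γ.take (i + 1)) (γ.drop i) else 0 := by
  simp_rw [← Finset.sum_filter, ← Finset.sum_product']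
  rw [Finset.sum_sigma', Finset.sum_sigma']
  -- The junction vertex belongs to both halves, so one copy is dropped. The default of `getD` is
  -- never read, as the position is below the length.
  refine Finset.sum_bij' (fun a _ => ⟨a.2.1.dropLast ++ a.2.2, a.2.1.length - 1⟩)
    (fun b _ => ⟨b.1.getD b.2 1, b.1.take (b.2 + 1), b.1.drop b.2⟩) ?_ ?_ ?_ ?_ ?_
  all_goals simp only [Finset.mem_sigma, Finset.mem_product, Finset.mem_filter,
    Finset.mem_range, mem_paths]
  · rintro ⟨x, δ, ε⟩ ⟨hx, hδ, hε⟩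
    dsimp only at hx hδ hε
    obtain ⟨δ, rfl⟩ := hδ.exists_eq_append
    obtain ⟨ε, rfl⟩ := hε.exists_eq_cons
    simp only [List.dropLast_concat, List.length_append, List.length_cons, List.length_nil]
    exact ⟨isPath_append_iff.2 ⟨hδ, hε⟩, by omega, by simpa using hx⟩
  · rintro ⟨γ, i⟩ ⟨hγ, hi, hI⟩
    obtain ⟨α, x, β, rfl, rfl⟩ := exists_append_cons_of_lt_length hi
    have := isPath_append_iff.1 hγ
    refine ⟨hI, ?_, ?_⟩
    · simpa [List.take_length_add_append] using this.1
    · simpa using this.2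
  · rintro ⟨x, δ, ε⟩ ⟨hx, hδ, hε⟩
    dsimp only at hx hδ hε
    obtain ⟨δ, rfl⟩ := hδ.exists_eq_append
    obtain ⟨ε, rfl⟩ := hε.exists_eq_cons
    simp [List.take_length_add_append]
  · rintro ⟨γ, i⟩ ⟨hγ, hi, hI⟩
    obtain ⟨α, x, β, rfl, rfl⟩ := exists_append_cons_of_lt_length hi
    simp [List.take_length_add_append]
  · rintro ⟨x, δ, ε⟩ ⟨hx, hδ, hε⟩
    dsimp only at hx hδ hε
    obtain ⟨δ, rfl⟩ := hδ.exists_eq_append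
    obtain ⟨ε, rfl⟩ := hε.exists_eq_cons
    simp [List.take_length_add_append]

/-- Summation by parts: each `e i` occurs in `f i` and in `f (i + 1)`, with opposite signs. -/
theorem sum_alternating_telescope {A : Type*} [CommRing A] (a e f : ℕ → A) (m : ℕ)
    (h0 : f 0 = e 0) (hmid : ∀ i < m, f (i + 1) = e (i + 1) + e i) (hlast : f (m + 1) = e m) :
    ∑ i ∈ Finset.range (m + 2), (-1) ^ i * a i * f i =
      ∑ i ∈ Finset.range (m + 1), (-1) ^ i * e i * (a i - a (i + 1)) := by
  have key : ∀ k ≤ m, ∑ i ∈ Finset.range (k + 1), (-1) ^ i * a i * f i =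
      ∑ i ∈ Finset.range k, (-1) ^ i * e i * (a i - a (i + 1)) + (-1) ^ k * a k * e k := by
    intro k hk
    induction k with
    | zero => simp [h0]
    | succ k ih =>
      rw [Finset.sum_range_succ, ih (by omega), Finset.sum_range_succ _ k, hmid k (by omega)]
      ring
  rw [Finset.sum_range_succ, key m le_rfl, hlast, Finset.sum_range_succ _ m]
  ring

/-- A transposition applied twice returns to the starting vertex, which the increasing length
forbids. This makes trichotomy applicable to adjacent labels. -/
theorem IsPath.isChain_ne_labels (h : IsPath u v γ) : (labels γ).IsChain (· ≠ ·) := by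
  have h' := h.1
  clear h
  induction γ with
  | nil => simp [labels]
  | cons x γ ih =>
    match γ with
    | [] => simp [labels]
    | [y] => simp [labels]
    | y :: z :: γ =>
      rw [List.isChain_cons_cons] at h'
      have := ih h'.2
      rw [labels_cons_cons] at this
      rw [labels_cons_cons, labels_cons_cons, List.isChain_cons_cons]
      refine ⟨fun he => ?_, this⟩
      have hyz := (List.isChain_cons_cons.1 h'.2).1
      obtain ⟨a, b, -, hs⟩ := h'.1.1
      have : z = x := by
        have h1 : y = Equiv.swap a b * x := by rw [← hs, inv_mul_cancel_right]
        have h2 : z = Equiv.swap a b * y := by rw [← hs, he, inv_mul_cancel_right]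
        rw [h2, h1, Equiv.swap_mul_self_mul]
      subst this
      exact lt_asymm h'.1.2 hyz.2

open Classical in
/-- The indicator of the paths that decrease up to their vertex `i` and increase from there on. -/
noncomputable def valleyAt (prec : Equiv.Perm (Fin n) → Equiv.Perm (Fin n) → Prop)
    (γ : List (Equiv.Perm (Fin n))) (i : ℕ) : ℤ[X] :=
  if Decreasing prec (γ.take (i + 1)) ∧ Increasing prec (γ.drop i) then 1 else 0

open Classical in
/-- The indicator of the paths that decrease up to their vertex `i + 1` and increase from their
vertex `i` on. -/
noncomputable def valleyEdgeAt (prec : Equiv.Perm (Fin n) → Equiv.Perm (Fin n) → Prop)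
    (γ : List (Equiv.Perm (Fin n))) (i : ℕ) : ℤ[X] :=
  if Decreasing prec (γ.take (i + 2)) ∧ Increasing prec (γ.drop i) then 1 else 0

theorem isChain_of_length_le_one {α : Type*} {r : α → α → Prop} {l : List α}
    (h : l.length ≤ 1) : l.IsChain r := by
  match l with
  | [] => simp
  | [x] => simp

theorem valleyAt_zero : valleyAt prec γ 0 = valleyEdgeAt prec γ 0 := by
  have h1 : Decreasing prec (γ.take (0 + 1)) :=
    isChain_of_length_le_one (by simp [length_labels])
  have h2 : Decreasing prec (γ.take (0 + 2)) :=
    isChain_of_length_le_one (by simp [length_labels])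
  classical
  exact if_congr ⟨fun h => ⟨h2, h.2⟩, fun h => ⟨h1, h.2⟩⟩ rfl rfl

theorem valleyAt_last {m : ℕ} (hm : γ.length = m + 2) :
    valleyAt prec γ (m + 1) = valleyEdgeAt prec γ m := by
  have h1 : Increasing prec (γ.drop (m + 1)) :=
    isChain_of_length_le_one (by simp [length_labels]; omega)
  have h2 : Increasing prec (γ.drop m) :=
    isChain_of_length_le_one (by simp [length_labels]; omega)
  classical
  exact if_congr ⟨fun h => ⟨h.1, h2⟩, fun h => ⟨h.1, h1⟩⟩ rfl rfl

/-- If the two labels at the marked vertex descend, the decreasing part extends over the edge after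
it; if they ascend, the increasing part extends over the edge before it. Exactly one of these
happens. -/
theorem valleyAt_succ (h : IsReflectionOrder prec) (hγ : IsPath u v γ) {m i : ℕ}
    (hm : γ.length = m + 2) (hi : i < m) :
    valleyAt prec γ (i + 1) = valleyEdgeAt prec γ (i + 1) + valleyEdgeAt prec γ i := by
  have hlen : (labels γ).length = m + 1 := by rw [length_labels]; omega
  have hi0 : i < (labels γ).length := by omega
  have hi1 : i + 1 < (labels γ).length := by omega
  have s1 := hγ.isSwap_of_mem_labels (List.getElem_mem hi0)
  have s2 := hγ.isSwap_of_mem_labels (List.getElem_mem hi1)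
  have hne : (labels γ)[i] ≠ (labels γ)[i + 1] := hγ.isChain_ne_labels.getElem i hi1
  have hdec : Decreasing prec (γ.take (i + 1 + 2)) ↔
      Decreasing prec (γ.take (i + 2)) ∧ prec (labels γ)[i + 1] (labels γ)[i] := by
    have e : (labels γ).take (i + 2) =
        (labels γ).take i ++ (labels γ)[i] :: [(labels γ)[i + 1]] := by
      rw [show i + 2 = i + 1 + 1 from rfl, ← List.take_concat_get' _ _ hi1,
        ← List.take_concat_get' _ _ hi0, List.append_assoc]
      rfl
    have e' : (labels γ).take (i + 1) = (labels γ).take i ++ [(labels γ)[i]] := by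
      rw [← List.take_concat_get' _ _ hi0]
    rw [Decreasing, Decreasing, labels_take γ (i + 2), labels_take γ (i + 1), e, e',
      List.isChain_split, List.isChain_pair]
  have hinc : Increasing prec (γ.drop i) ↔
      prec (labels γ)[i] (labels γ)[i + 1] ∧ Increasing prec (γ.drop (i + 1)) := by
    rw [Increasing, Increasing, labels_drop, labels_drop, List.drop_eq_getElem_cons hi0,
      List.drop_eq_getElem_cons hi1, List.isChain_cons_cons]
  have hx := h.asymm s1 s2
  have ht := h.trichotomy s1 s2 hne
  unfold valleyAt valleyEdgeAt
  split_ifs <;> grind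

open Classical in
theorem relRTilde_eq_sum_marked (h : IsReflectionOrder prec)
    (I : Finset (Equiv.Perm (Fin n))) (u v : Equiv.Perm (Fin n)) :
    relRTilde u v I = ∑ γ ∈ paths u v, (X : ℤ[X]) ^ pathLength γ *
      ∑ i ∈ Finset.range γ.length,
        (-1) ^ i * (if γ.getD i 1 ∈ I then 1 else 0) * valleyAt prec γ i := by
  have h1 : relRTilde u v I = ∑ x ∈ I, ∑ δ ∈ paths u x, ∑ ε ∈ paths x v,
      (if Decreasing prec δ then (-X) ^ pathLength δ else 0) *
        (if Increasing prec ε then X ^ pathLength ε else 0) := by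
    refine Finset.sum_congr rfl fun x _ => ?_
    rw [rTilde_eq_sum_decreasing h u x, rTilde_eq_sum_increasing h x v,
      Polynomial.sum_comp, Finset.sum_filter, Finset.sum_filter, Finset.sum_mul_sum]
    simp
  rw [h1, sum_paths_mul_eq I u v fun δ ε =>
    (if Decreasing prec δ then (-X) ^ pathLength δ else 0) *
      (if Increasing prec ε then X ^ pathLength ε else 0)]
  refine Finset.sum_congr rfl fun γ _ => ?_
  rw [Finset.mul_sum]
  refine Finset.sum_congr rfl fun i hi => ?_
  rw [Finset.mem_range] at hi
  have e1 : pathLength (γ.take (i + 1)) = i := by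
    rw [pathLength, List.length_take]; omega
  have e2 : pathLength γ = i + pathLength (γ.drop i) := by
    rw [pathLength, pathLength, List.length_drop]; omega
  -- The sign `(-1) ^ i` comes from evaluating the first factor at `-q`.
  rw [e1, e2, valleyAt, neg_pow (X : ℤ[X]) i, pow_add]
  by_cases c1 : γ.getD i 1 ∈ I <;> by_cases c2 : Decreasing prec (γ.take (i + 1)) <;>
    by_cases c3 : Increasing prec (γ.drop i) <;> simp only [c1, c2, c3, and_self, and_true,
      and_false, if_true, if_false] <;> ring

open Classical in
theorem sum_marked_eq (h : IsReflectionOrder prec) (hγ : IsPath u v γ) {m : ℕ}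
    (hm : γ.length = m + 2) (I : Finset (Equiv.Perm (Fin n))) :
    ∑ i ∈ Finset.range γ.length,
        (-1) ^ i * (if γ.getD i 1 ∈ I then 1 else 0) * valleyAt prec γ i =
      ∑ i ∈ Finset.range (m + 1), (-1) ^ i * valleyEdgeAt prec γ i *
        ((if γ.getD i 1 ∈ I then 1 else 0) - if γ.getD (i + 1) 1 ∈ I then 1 else 0) := by
  rw [hm]
  exact sum_alternating_telescope (fun i => if γ.getD i 1 ∈ I then 1 else 0) _ _ m valleyAt_zero
    (fun i hi => valleyAt_succ h hγ hm hi) (valleyAt_last hm)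

theorem IsPath.exists_length_eq (hγ : IsPath u v γ) (huv : u ≠ v) : ∃ m, γ.length = m + 2 := by
  match γ, hγ with
  | [], hγ => exact absurd rfl hγ.ne_nil
  | [x], hγ => exact absurd (by simpa [IsPath] using hγ) fun h : x = u ∧ x = v => huv (h.1 ▸ h.2)
  | x :: y :: γ, _ => exact ⟨γ.length, rfl⟩

/-! ### The case of the whole interval. -/

theorem mem_interval {x : Equiv.Perm (Fin n)} :
    x ∈ interval u v ↔ BruhatLE u x ∧ BruhatLE x v := by
  simp [interval]

theorem IsPath.mem_interval (hγ : IsPath u v γ) {x : Equiv.Perm (Fin n)} (hx : x ∈ γ) :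
    x ∈ interval u v := by
  obtain ⟨α, β, rfl⟩ := List.append_of_mem hx
  have := isPath_append_iff.1 hγ
  exact BruhatGraph.mem_interval.2 ⟨this.1.bruhatLE, this.2.bruhatLE⟩

theorem relRTilde_interval_of_ne (h : IsReflectionOrder prec) (huv : u ≠ v) :
    relRTilde u v (interval u v) = 0 := by
  classical
  rw [relRTilde_eq_sum_marked h]
  refine Finset.sum_eq_zero fun γ hγ => ?_
  rw [mem_paths] at hγ
  obtain ⟨m, hm⟩ := hγ.exists_length_eq huv
  have hmem : ∀ i < m + 2, γ.getD i 1 ∈ interval u v := fun i hi => by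
    rw [List.getD_eq_getElem _ _ (by omega)]
    exact hγ.mem_interval (List.getElem_mem _)
  rw [sum_marked_eq h hγ hm, Finset.sum_eq_zero, mul_zero]
  intro i hi
  rw [Finset.mem_range] at hi
  rw [if_pos (hmem i (by omega)), if_pos (hmem (i + 1) (by omega)), sub_self, mul_zero]

theorem bruhatLE_antisymm {x y : Equiv.Perm (Fin n)} (h1 : BruhatLE x y) (h2 : BruhatLE y x) :
    x = y := by
  by_contra hne
  exact (h1.len_lt hne).not_ge h2.len_le

theorem interval_self (u : Equiv.Perm (Fin n)) : interval u u = {u} := by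
  ext x
  rw [mem_interval, Finset.mem_singleton]
  exact ⟨fun h => bruhatLE_antisymm h.2 h.1, fun h => h ▸
    ⟨Relation.ReflTransGen.refl, Relation.ReflTransGen.refl⟩⟩

theorem rTilde_self (h : IsReflectionOrder prec) (u : Equiv.Perm (Fin n)) : RTilde u u = 1 := by
  obtain ⟨L, hL⟩ := h.exists_enumerates
  rw [rTilde_eq_incPoly h hL, incPoly_self fun t => (hL.mem_iff t).1]

theorem relRTilde_interval (h : IsReflectionOrder prec) (u v : Equiv.Perm (Fin n)) :
    relRTilde u v (interval u v) = if u = v then 1 else 0 := by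
  split_ifs with huv
  · subst huv
    simp [interval_self, relRTilde, rTilde_self h]
  · exact relRTilde_interval_of_ne h huv

/-! ### The case of a proper order ideal. -/

theorem exists_append_of_isChain {α : Type*} {p : α → Prop} {l : List α}
    (hl : l.IsChain fun x y => p y → p x) :
    ∃ l₁ l₂, l = l₁ ++ l₂ ∧ (∀ x ∈ l₁, p x) ∧ ∀ x ∈ l₂, ¬ p x := by
  induction l with
  | nil => exact ⟨[], [], rfl, by simp, by simp⟩
  | cons a l ih =>
    rw [List.isChain_cons] at hl
    obtain ⟨l₁, l₂, rfl, h₁, h₂⟩ := ih hl.2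
    by_cases ha : p a
    · exact ⟨a :: l₁, l₂, rfl, by simpa using ⟨ha, h₁⟩, h₂⟩
    · cases l₁ with
      | nil => exact ⟨[], a :: l₂, rfl, by simp, by simpa using ⟨ha, h₂⟩⟩
      | cons b l₁ => exact absurd (hl.1 b (by simp) (h₁ b (by simp))) ha

/-- A path from `u ∈ I` to `v ∉ I` leaves the order ideal `I` exactly once. -/
theorem IsPath.exists_exit (hγ : IsPath u v γ) (hI : IsOrderIdeal u v I) (hu : u ∈ I)
    (hv : v ∉ I) : ∃ α x y β, γ = α ++ x :: y :: β ∧ (∀ z ∈ α, z ∈ I) ∧ x ∈ I ∧ y ∉ I ∧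
      ∀ z ∈ β, z ∉ I := by
  obtain ⟨γ₁, γ₂, rfl, h₁, h₂⟩ := exists_append_of_isChain (p := (· ∈ I)) (l := γ)
    (hγ.1.imp_of_mem_imp fun x y hx _ hxy hyI =>
      hI.2 y hyI x (hγ.mem_interval hx) (Relation.ReflTransGen.single hxy))
  rcases γ₁.eq_nil_or_concat with rfl | ⟨α, x, rfl⟩
  · exact absurd hu (h₂ u (List.mem_of_mem_head? (by simpa using hγ.2.1)))
  rw [List.concat_eq_append] at hγ h₁ ⊢
  cases γ₂ with
  | nil => exact absurd (h₁ v (List.mem_of_getLast? (by simpa using hγ.2.2))) hv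
  | cons y β =>
    simp only [List.mem_append, List.mem_cons, List.not_mem_nil, or_false] at h₁ h₂
    exact ⟨α, x, y, β, by simp, fun z hz => h₁ z (Or.inl hz), h₁ x (Or.inr rfl),
      h₂ y (Or.inl rfl), fun z hz => h₂ z (Or.inr hz)⟩

/-- The last vertex in `I` is unique, so any decomposition witnessing `IsIdealPath` is the given
one. -/
theorem isIdealPath_iff_of_exit {α β : List (Equiv.Perm (Fin n))} {x y : Equiv.Perm (Fin n)}
    (hγ : IsPath u v (α ++ x :: y :: β)) (hx : x ∈ I) (hy : y ∉ I) (hβ : ∀ z ∈ β, z ∉ I) :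
    IsIdealPath prec I u v (α ++ x :: y :: β) ↔
      Decreasing prec ((α ++ x :: y :: β).take (α.length + 2)) ∧
        Increasing prec ((α ++ x :: y :: β).drop α.length) := by
  have e1 : (α ++ x :: y :: β).take (α.length + 2) = α ++ x :: (y :: β).take 1 := by
    simp [List.take_length_add_append]
  have e2 : (α ++ x :: y :: β).drop α.length = x :: y :: β := by simp
  rw [e1, e2]
  constructor
  · rintro ⟨-, α', x', β', he, hx', hβ', hd, hi⟩
    have hyβ : ∀ z ∈ y :: β, z ∉ I := by simpa using ⟨hy, hβ⟩
    have : α = α' ∧ x = x' ∧ y :: β = β' := by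
      rcases List.append_eq_append_iff.1 he with ⟨as, rfl, has⟩ | ⟨as, rfl, has⟩
      · cases as with
        | nil => simpa using has
        | cons b as =>
          rw [List.cons_append, List.cons.injEq] at has
          exact absurd hx' (hyβ x' (by rw [has.2]; simp))
      · cases as with
        | nil => simpa [eq_comm] using has
        | cons b as =>
          rw [List.cons_append, List.cons.injEq] at has
          exact absurd hx (hβ' x (by rw [has.2]; simp))
    obtain ⟨rfl, rfl, rfl⟩ := this
    exact ⟨hd, hi⟩
  · rintro ⟨hd, hi⟩
    exact ⟨hγ, α, x, y :: β, rfl, hx, by simpa using ⟨hy, hβ⟩, hd, hi⟩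

open Classical in
theorem sum_marked_eq_of_isOrderIdeal (h : IsReflectionOrder prec) (hγ : IsPath u v γ)
    (hI : IsOrderIdeal u v I) (hu : u ∈ I) (hv : v ∉ I) :
    ∑ i ∈ Finset.range γ.length,
        (-1) ^ i * (if γ.getD i 1 ∈ I then 1 else 0) * valleyAt prec γ i =
      if IsIdealPath prec I u v γ then (-1) ^ pathLength (restrict γ I) else 0 := by
  obtain ⟨α, x, y, β, rfl, hα, hx, hy, hβ⟩ := hγ.exists_exit hI hu hv
  have hin : ∀ i ≤ α.length, (α ++ x :: y :: β).getD i 1 ∈ I := by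
    intro i hi
    rcases hi.lt_or_eq with hi | rfl
    · rw [List.getD_append _ _ _ _ hi, List.getD_eq_getElem _ _ hi]
      exact hα _ (List.getElem_mem _)
    · simpa using hx
  have hout : ∀ i < β.length + 1, (α ++ x :: y :: β).getD (α.length + 1 + i) 1 ∉ I := by
    intro i hi
    have hyβ : ∀ z ∈ y :: β, z ∉ I := by simpa using ⟨hy, hβ⟩
    rw [List.getD_append_right _ _ _ _ (by omega),
      show α.length + 1 + i - α.length = i + 1 by omega, List.getD_cons_succ,
      List.getD_eq_getElem _ _ (by simpa using hi)]
    exact hyβ _ (List.getElem_mem _)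
  rw [sum_marked_eq h hγ (m := α.length + β.length) (by simp; omega),
    -- Membership in `I` changes only along the exit edge from `x` to `y`, at index `α.length`,
    -- which is also the length of the part in `I`.
    Finset.sum_eq_single α.length]
  · rw [if_pos (hin _ le_rfl), if_neg (hout 0 (by omega)), sub_zero, mul_one, valleyEdgeAt]
    have e : pathLength (restrict (α ++ x :: y :: β) I) = α.length := by
      rw [pathLength, restrict, List.filter_append, List.filter_eq_self.2 (by simpa using hα),
        List.filter_cons_of_pos (by simpa using hx), List.filter_eq_nil_iff.2 (by
          simpa using ⟨hy, hβ⟩)]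
      simp
    rw [e]
    simp only [isIdealPath_iff_of_exit hγ hx hy hβ, mul_ite, mul_one, mul_zero]
  · intro i hi hne
    rw [Finset.mem_range] at hi
    rcases lt_or_gt_of_ne hne with hlt | hgt
    · rw [if_pos (hin i hlt.le), if_pos (hin (i + 1) hlt), sub_self, mul_zero]
    · obtain ⟨j, rfl⟩ : ∃ j, i = α.length + 1 + j := ⟨i - α.length - 1, by omega⟩
      rw [if_neg (hout j (by omega)), add_assoc _ j 1, if_neg (hout (j + 1) (by omega)), sub_self,
        mul_zero]
  · intro hni
    exact absurd (Finset.mem_range.2 (by omega)) hni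

theorem IsOrderIdeal.left_mem (hI : IsOrderIdeal u v I) (hne : I.Nonempty) : u ∈ I := by
  obtain ⟨x, hx⟩ := hne
  have := mem_interval.1 (hI.1 hx)
  exact hI.2 x hx u (mem_interval.2 ⟨Relation.ReflTransGen.refl, this.1.trans this.2⟩) this.1

theorem IsOrderIdeal.right_notMem (hI : IsOrderIdeal u v I) (hne : I ≠ interval u v) : v ∉ I :=
  fun hv => hne (hI.1.antisymm fun x hx => hI.2 v hv x hx (mem_interval.1 hx).2)

theorem relRTilde_eq_sum_idealPaths (h : IsReflectionOrder prec) (hI : IsOrderIdeal u v I)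
    (hne : I.Nonempty) (hI' : I ≠ interval u v) :
    relRTilde u v I = ∑ γ ∈ idealPaths prec I u v,
      (-1) ^ pathLength (restrict γ I) * (X : ℤ[X]) ^ pathLength γ := by
  classical
  have e : idealPaths prec I u v = (paths u v).filter fun γ => IsIdealPath prec I u v γ := by
    ext γ
    simp only [idealPaths, Set.Finite.mem_toFinset, Set.mem_ofPred_eq, Finset.mem_filter, mem_paths]
    exact ⟨fun h => ⟨h.1, h⟩, fun h => h.2⟩
  rw [relRTilde_eq_sum_marked h, e, Finset.sum_filter]
  refine Finset.sum_congr rfl fun γ hγ => ?_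
  rw [sum_marked_eq_of_isOrderIdeal h (mem_paths.1 hγ) hI (hI.left_mem hne) (hI.right_notMem hI')]
  split_ifs <;> ring

end BruhatGraph

theorem proposition3p2 (n : ℕ) (u v : Equiv.Perm (Fin n)) :
    (BruhatGraph.relRTilde u v (BruhatGraph.interval u v) = if u = v then 1 else 0) ∧
    ∀ (I : Finset (Equiv.Perm (Fin n)))
      (prec : Equiv.Perm (Fin n) → Equiv.Perm (Fin n) → Prop),
      BruhatGraph.IsOrderIdeal u v I → I.Nonempty → I ≠ BruhatGraph.interval u v →
      BruhatGraph.IsReflectionOrder prec →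
      BruhatGraph.relRTilde u v I =
        ∑ γ ∈ BruhatGraph.idealPaths prec I u v,
          (-1) ^ BruhatGraph.pathLength (BruhatGraph.restrict γ I) *
            (X : ℤ[X]) ^ BruhatGraph.pathLength γ := by
  obtain ⟨prec₀, h₀⟩ := BruhatGraph.exists_isReflectionOrder n
  exact ⟨BruhatGraph.relRTilde_interval h₀ u v, fun I prec hI hne hI' h =>
    BruhatGraph.relRTilde_eq_sum_idealPaths h hI hne hI'⟩
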